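/- **Conventions.** Let $n\ge 1$, $\mathbb R_+=(0,\infty)$, and let all functions be Lebesgue measurable. For $f$ on $\mathbb R^n$ (complex- or $[0,\infty]$-valued) put $f^*(t)=\inf\{y>0:|\{x:|f(x)|>y\}|\le t\}$ and $f^{**}(t)=\frac1t\int_0^t f^*(\tau)\,d\tau$, $t>0$. Let $E=E(\mathbb R^n)$ and $X=X(\mathbb R^n)$ be rearrangement-invariant Banach function spaces in the sense of Bennett–Sharpley, that is, $X=\{f:\|f\|_X=\rho(|f|)<\infty\}$ for a functional norm $\rho$ with $\rho(f)\le\rho(g)$ whenever $f^*\le g^*$, and likewise $E$. Let $\widetilde X(\mathbb R_+)$ be the Luxemburg representation of $X$: the rearrangement-invariant space on $\mathbb R_+$ with $\|f\|_X=\|f^*\|_{\widetilde X}$. For $\Phi:(0,\infty)\to(0,\infty)$ write $\Phi\in B_n(\infty)$ if $\Phi$ is non-increasing and continuous and, for some $C>0$, $\int_0^r\Phi(\rho)\rho^{n-1}\,d\rho\le C\,\Phi(r)r^n$ for all $r>0$; write $\Phi\in D(\infty)$ if, for some $C>0$, $\int_0^{r^n}\frac{ds}{\Phi(s^{1/n})s}\le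 \frac{C}{\Phi(r)}$ for all $r>0$. Let $(M_\Phi f)(x)=\sup_{r>0}\Phi(r)\int_{B(x,r)}|f(y)|\,dy\in[0,\infty]$ and $$M_E^\Phi(\mathbb R^n)=\{M_\Phi f: f\in E\},\qquad \|u\|_{M_E^\Phi}=\inf\{\|f\|_E: f\in E,\ M_\Phi f=u\}.$$ Consider the following sets of non-negative, possibly infinite-valued, functions $h$ on $\mathbb R_+$: - $K_1$: $h=u^*$ with $u\in M_E^\Phi$; - $K_2$: $h=u^{**}$ with $u\in M_E^\Phi$; - $K_3$: $h(t)=\sup_{\tau>t}\tau\Phi(\tau^{1/n})u^{**}(\tau)$ with $u\in E$; - $K_4$: $h(t)=t\Phi(t^{1/n})u^{**}(t)+\sup_{\tau>t}\tau\Phi(\tau^{1/n})u^{*}(\tau)$ with $u\in E$. For $h\in K_i$ let $\rho_{K_i}(h)$ be the infimum of $\|u\|_{M_E^\Phi}$ (for $i=1,2$), respectively of $\|u\|_E$ (for $i=3,4$), over all $u$ representing $h$ in this way on $\mathbb R_+$. Write $K_i\mapsto\widetilde X(\mathbb R_+)$ if $K_i\subset\widetilde X(\mathbb R_+)$ and there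 is a constant $C>0$ with $\|h\|_{\widetilde X}\le C\rho_{K_i}(h)$ for all $h\in K_i$. **Corollary 4.2.** Let $\Phi\in B_n(\infty)$. 1. For each $i\in\{1,2,3\}$: $M_E^\Phi(\mathbb R^n)\subset X(\mathbb R^n)$ if and only if $K_i\mapsto\widetilde X(\mathbb R_+)$. 2. If moreover $\Phi\in D(\infty)$, the same equivalence holds also for $i=4$. Here the set inclusion $M_E^\Phi\subset X$ is equivalent to the bounded embedding $M_E^\Phi\hookrightarrow X$, that is, to the inclusion together with $\|u\|_X\le C\|u\|_{M_E^\Phi}$ for all $u\in M_E^\Phi$ and some constant $C>0$; so the equivalences hold for either reading. -/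

import Mathlib

open MeasureTheory Set Filter Topology
open scoped ENNReal NNReal

namespace FracMax

/-- Non-increasing rearrangement `f^*(t) = inf {y > 0 : μ {x : f x > y} ≤ t}` (meant for `t > 0`) of a
`[0,∞]`-valued function; for a complex function `f` it is applied to `|f|`. -/
noncomputable def rearr {α : Type*} [MeasurableSpace α] (μ : Measure α) (f : α → ℝ≥0∞) (t : ℝ) :
    ℝ≥0∞ :=
  sInf {y : ℝ≥0∞ | 0 < y ∧ μ {x | y < f x} ≤ ENNReal.ofReal t}

/-- `f^{**}(t) = (1/t) ∫_0^t f^*(τ) dτ` (meant for `t > 0`). -/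
noncomputable def rearrAvg {α : Type*} [MeasurableSpace α] (μ : Measure α) (f : α → ℝ≥0∞) (t : ℝ) :
    ℝ≥0∞ :=
  (ENNReal.ofReal t)⁻¹ * ∫⁻ τ in Ioo 0 t, rearr μ f τ

/-- Functional norms in the sense of Bennett and Sharpley, on the `μ`-measurable functions with values in
`[0,∞]` (the values of `ρ` on non-measurable functions are irrelevant). -/
structure IsFunctionNorm {α : Type*} [MeasurableSpace α] (μ : Measure α)
    (ρ : (α → ℝ≥0∞) → ℝ≥0∞) : Prop where
  eq_zero_iff : ∀ f, AEMeasurable f μ → (ρ f = 0 ↔ f =ᵐ[μ] 0)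
  smul : ∀ (a : ℝ≥0) (f), AEMeasurable f μ → ρ (fun x => a * f x) = a * ρ f
  add_le : ∀ f g, AEMeasurable f μ → AEMeasurable g μ → ρ (fun x => f x + g x) ≤ ρ f + ρ g
  mono : ∀ f g, AEMeasurable f μ → AEMeasurable g μ → f ≤ᵐ[μ] g → ρ f ≤ ρ g
  fatou : ∀ (F : ℕ → α → ℝ≥0∞) (f : α → ℝ≥0∞), (∀ k, AEMeasurable (F k) μ) → AEMeasurable f μ →
    (∀ k, F k ≤ᵐ[μ] F (k + 1)) → (∀ᵐ x ∂μ, Tendsto (fun k => F k x) atTop (𝓝 (f x))) →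
    Tendsto (fun k => ρ (F k)) atTop (𝓝 (ρ f))
  lintegral_le : ∀ s, MeasurableSet s → 0 < μ s → μ s < ∞ →
    ∃ c : ℝ≥0, ∀ f, AEMeasurable f μ → ∫⁻ x in s, f x ∂μ ≤ c * ρ f
  indicator_lt_top : ∀ s, MeasurableSet s → 0 < μ s → μ s < ∞ → ρ (s.indicator fun _ => 1) < ∞

/-- Rearrangement-invariant functional norms. -/
structure IsRINorm {α : Type*} [MeasurableSpace α] (μ : Measure α)
    (ρ : (α → ℝ≥0∞) → ℝ≥0∞) : Prop extends IsFunctionNorm μ ρ where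
  rearr_mono : ∀ f g, AEMeasurable f μ → AEMeasurable g μ →
    (∀ t, 0 < t → rearr μ f t ≤ rearr μ g t) → ρ f ≤ ρ g

/-- Membership of a non-negative function in the space `X(ρ)`. Finiteness of `ρ g` forces `g` to be
finite almost everywhere. -/
def MemSpace {α : Type*} [MeasurableSpace α] (μ : Measure α) (ρ : (α → ℝ≥0∞) → ℝ≥0∞)
    (g : α → ℝ≥0∞) : Prop :=
  AEMeasurable g μ ∧ ρ g < ∞

/-- The space `X(ρ)` of complex measurable functions `f` with `ρ(|f|) < ∞`. -/
def space {α : Type*} [MeasurableSpace α] (μ : Measure α) (ρ : (α → ℝ≥0∞) → ℝ≥0∞) :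
    Set (α → ℂ) :=
  {f | AEMeasurable f μ ∧ ρ (fun x => ‖f x‖ₑ) < ∞}

/-- `ℝ^n` with the Euclidean norm. -/
abbrev Rn (n : ℕ) : Type := EuclideanSpace ℝ (Fin n)

/-- Lebesgue measure on `ℝ_+ = (0,∞)`. -/
noncomputable abbrev volPos : Measure ℝ := volume.restrict (Ioi 0)

/-- The map `x ↦ v_n |x|^n` from `ℝ^n` to `ℝ_+`, where `v_n` is the volume of the unit ball. -/
noncomputable def radial (n : ℕ) (x : Rn n) : ℝ :=
  (volume (Metric.ball (0 : Rn n) 1)).toReal * ‖x‖ ^ n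

/-- The Luxemburg representation on `ℝ_+` of a rearrangement-invariant norm `ρ` on `ℝ^n`. By the two
theorems `luxemburg_isRINorm` and `luxemburg_rearr` below it is the rearrangement-invariant norm on
`ℝ_+` with `ρ(f) = ρ~(f^*)`. -/
noncomputable def luxemburg (n : ℕ) (ρ : (Rn n → ℝ≥0∞) → ℝ≥0∞) (h : ℝ → ℝ≥0∞) : ℝ≥0∞ :=
  ρ (fun x => h (radial n x))

theorem radial_measurePreserving (n : ℕ) (hn : 1 ≤ n) :
    MeasurePreserving (radial n) volume volPos := by
  have hmeas : Measurable (radial n) := by unfold radial; fun_prop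
  have : Nonempty (Fin n) := ⟨⟨0, hn⟩⟩
  set v := (volume (Metric.ball (0 : Rn n) 1)).toReal with hv
  have hv0 : 0 < v := ENNReal.toReal_pos (Metric.measure_ball_pos _ _ one_pos).ne'
    measure_ball_lt_top.ne
  have key : ∀ b : ℝ, volume (radial n ⁻¹' Iio b) = volPos (Iio b) := by
    intro b
    rw [Measure.restrict_apply measurableSet_Iio, inter_comm, Ioi_inter_Iio, Real.volume_Ioo, sub_zero]
    rcases le_or_gt b 0 with hb | hb
    · rw [ENNReal.ofReal_of_nonpos hb]
      convert measure_empty (μ := (volume : Measure (Rn n)))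
      ext x
      have : 0 ≤ radial n x := by unfold radial; positivity
      simp only [mem_preimage, mem_Iio, mem_empty_iff_false, iff_false, not_lt]
      linarith
    · obtain ⟨r, hr, hrb⟩ : ∃ r : ℝ, 0 < r ∧ r ^ n = b / v :=
        ⟨(b / v) ^ (1 / (n : ℝ)), by positivity, by
          rw [one_div]; exact Real.rpow_inv_natCast_pow (by positivity) (by omega)⟩
      have : radial n ⁻¹' Iio b = Metric.ball 0 r := by
        ext x
        simp only [radial, mem_preimage, mem_Iio, mem_ball_zero_iff]
        rw [← hv, mul_comm, ← lt_div_iff₀ hv0, ← hrb]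
        exact pow_lt_pow_iff_left₀ (norm_nonneg _) hr.le (by omega)
      rw [this, Measure.addHaar_ball _ _ hr.le, finrank_euclideanSpace_fin, hrb]
      rw [← ENNReal.ofReal_toReal (a := volume (Metric.ball (0 : Rn n) 1)) measure_ball_lt_top.ne,
        ← hv, ← ENNReal.ofReal_mul (by positivity)]
      congr 1
      field_simp
  refine ⟨hmeas, ?_⟩
  refine Measure.ext_of_generateFrom_of_iUnion (range Iio) (fun k : ℕ => Iio (k : ℝ))
    (borel_eq_generateFrom_Iio ℝ ▸ BorelSpace.measurable_eq) isPiSystem_Iio ?_ (by simp) ?_ ?_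
  · refine iUnion_eq_univ_iff.2 fun x => ?_
    exact exists_nat_gt x
  · intro k
    rw [Measure.map_apply hmeas measurableSet_Iio, key,
      Measure.restrict_apply measurableSet_Iio, inter_comm, Ioi_inter_Iio, Real.volume_Ioo]
    exact ENNReal.ofReal_ne_top
  · rintro _ ⟨b, rfl⟩
    rw [Measure.map_apply hmeas measurableSet_Iio, key]

theorem rearr_comp {α β : Type*} [MeasurableSpace α] [MeasurableSpace β] {μ : Measure α}
    {ν : Measure β} {T : α → β} (hT : MeasurePreserving T μ ν) {h : β → ℝ≥0∞}
    (hh : AEMeasurable h ν) (t : ℝ) : rearr μ (fun x => h (T x)) t = rearr ν h t := by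
  unfold rearr
  congr 1
  ext y
  have : μ {x | y < h (T x)} = ν {x | y < h x} :=
    hT.measure_preimage (nullMeasurableSet_lt aemeasurable_const hh)
  simp only [mem_ofPred_eq, this]

theorem lt_rearr_iff {α : Type*} [MeasurableSpace α] (μ : Measure α) (f : α → ℝ≥0∞) (t : ℝ)
    (y : ℝ≥0∞) : y < rearr μ f t ↔ ENNReal.ofReal t < μ {x | y < f x} := by
  rw [← not_le, ← not_le, not_iff_not]
  constructor
  · intro h
    by_contra! hlt
    have hU : {x | y < f x} = ⋃ q ∈ {q : ℚ | y < ENNReal.ofReal q}, {x | ENNReal.ofReal q < f x} := by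
      ext x
      simp only [mem_ofPred_eq, mem_iUnion, exists_prop]
      constructor
      · intro hx
        obtain ⟨q, hq0, h1, h2⟩ := ENNReal.lt_iff_exists_rat_btwn.1 hx
        exact ⟨q, h1, h2⟩
      · rintro ⟨q, h1, h2⟩
        exact h1.trans h2
    have hdir : DirectedOn (Function.onFun (· ⊆ ·) fun q : ℚ => {x | ENNReal.ofReal q < f x})
        {q : ℚ | y < ENNReal.ofReal q} := by
      intro a ha b hb
      refine ⟨min a b, ?_, ?_, ?_⟩
      · rcases min_choice a b with h | h <;> rw [h] <;> assumption
      · intro x hx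
        exact lt_of_le_of_lt (ENNReal.ofReal_le_ofReal (by exact_mod_cast min_le_left a b)) hx
      · intro x hx
        exact lt_of_le_of_lt (ENNReal.ofReal_le_ofReal (by exact_mod_cast min_le_right a b)) hx
    rw [hU, measure_biUnion_eq_iSup (to_countable _) hdir] at hlt
    obtain ⟨q, hq⟩ := lt_iSup_iff.1 hlt
    obtain ⟨hyq, hq⟩ := lt_iSup_iff.1 hq
    obtain ⟨z, hz, hzq⟩ := sInf_lt_iff.1 (lt_of_le_of_lt h hyq)
    refine absurd (hz.2) (not_le.2 (hq.trans_le (measure_mono fun x hx => ?_)))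
    exact hzq.trans hx
  · intro h
    by_cases hy : y = ∞
    · simp [hy]
    refine le_of_forall_gt_imp_ge_of_dense fun z hz => sInf_le ⟨lt_of_le_of_lt bot_le hz, ?_⟩
    exact (measure_mono fun x hx => hz.trans hx).trans h

theorem rearr_antitone {α : Type*} [MeasurableSpace α] (μ : Measure α) (f : α → ℝ≥0∞) :
    Antitone (rearr μ f) := fun _ _ hst =>
  sInf_le_sInf fun _ hy => ⟨hy.1, hy.2.trans (ENNReal.ofReal_le_ofReal hst)⟩

theorem rearr_rearr {α : Type*} [MeasurableSpace α] (μ : Measure α) (f : α → ℝ≥0∞) (t : ℝ) :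
    rearr volPos (rearr μ f) t = rearr μ f t := by
  refine eq_of_forall_lt_iff fun y => ?_
  rw [lt_rearr_iff, lt_rearr_iff]
  have : volPos {s | y < rearr μ f s} = μ {x | y < f x} := by
    have hm : MeasurableSet {s | y < rearr μ f s} :=
      measurableSet_lt measurable_const (rearr_antitone μ f).measurable
    rw [Measure.restrict_apply hm]
    simp only [lt_rearr_iff]
    rcases eq_or_ne (μ {x | y < f x}) ∞ with h | h
    · rw [h]
      simp
    · have : {s | ENNReal.ofReal s < μ {x | y < f x}} ∩ Ioi 0 = Ioo 0 (μ {x | y < f x}).toReal := by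
        ext s
        simp only [mem_inter_iff, mem_ofPred_eq, mem_Ioi, mem_Ioo]
        constructor
        · rintro ⟨h1, h2⟩
          exact ⟨h2, (ENNReal.ofReal_lt_iff_lt_toReal h2.le h).1 h1⟩
        · rintro ⟨h1, h2⟩
          exact ⟨(ENNReal.ofReal_lt_iff_lt_toReal h1.le h).2 h2, h1⟩
      rw [this, Real.volume_Ioo, sub_zero, ENNReal.ofReal_toReal h]
  rw [this]

theorem luxemburg_isRINorm {n : ℕ} (hn : 1 ≤ n) {ρ : (Rn n → ℝ≥0∞) → ℝ≥0∞}
    (hρ : IsRINorm volume ρ) : IsRINorm volPos (luxemburg n ρ) := by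
  have hT := radial_measurePreserving n hn
  have hm : ∀ {f : ℝ → ℝ≥0∞}, AEMeasurable f volPos → AEMeasurable (fun x => f (radial n x)) volume :=
    fun hf => hf.comp_quasiMeasurePreserving hT.quasiMeasurePreserving
  have hae : ∀ {p : ℝ → Prop}, (∀ᵐ x ∂volPos, p x) → ∀ᵐ x : Rn n, p (radial n x) :=
    fun hp => hT.quasiMeasurePreserving.ae hp
  refine { eq_zero_iff := ?_, smul := ?_, add_le := ?_, mono := ?_, fatou := ?_, lintegral_le := ?_,
           indicator_lt_top := ?_, rearr_mono := ?_ }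
  · intro f hf
    refine (hρ.eq_zero_iff _ (hm hf)).trans ⟨fun h => ?_, fun h => hae h⟩
    rw [← lintegral_eq_zero_iff' (hm hf)] at h
    rw [← lintegral_eq_zero_iff' hf, ← hT.map_eq, lintegral_map' (hT.map_eq.symm ▸ hf)
      hT.measurable.aemeasurable]
    exact h
  · intro a f hf
    exact hρ.smul a _ (hm hf)
  · intro f g hf hg
    exact hρ.add_le _ _ (hm hf) (hm hg)
  · intro f g hf hg hfg
    exact hρ.mono _ _ (hm hf) (hm hg) (hae hfg)
  · intro F f hF hf h1 h2
    exact hρ.fatou _ _ (fun k => hm (hF k)) (hm hf) (fun k => hae (h1 k)) (hae h2)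
  · intro s hs h0 h1
    rw [← hT.measure_preimage hs.nullMeasurableSet] at h0 h1
    obtain ⟨c, hc⟩ := hρ.lintegral_le _ (hT.measurable hs) h0 h1
    refine ⟨c, fun f hf => ?_⟩
    have hr := (hT.restrict_preimage hs)
    rw [← hr.map_eq, lintegral_map' (hr.map_eq.symm ▸ hf.mono_measure Measure.restrict_le_self)
      hT.measurable.aemeasurable]
    exact hc _ (hm hf)
  · intro s hs h0 h1
    rw [← hT.measure_preimage hs.nullMeasurableSet] at h0 h1
    exact hρ.indicator_lt_top _ (hT.measurable hs) h0 h1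
  · intro f g hf hg h
    refine hρ.rearr_mono _ _ (hm hf) (hm hg) fun t ht => ?_
    rw [rearr_comp hT hf, rearr_comp hT hg]
    exact h t ht

theorem luxemburg_rearr {n : ℕ} (hn : 1 ≤ n) {ρ : (Rn n → ℝ≥0∞) → ℝ≥0∞}
    (hρ : IsRINorm volume ρ) {f : Rn n → ℝ≥0∞} (hf : AEMeasurable f volume) :
    luxemburg n ρ (rearr volume f) = ρ f := by
  have hT := radial_measurePreserving n hn
  have hr : AEMeasurable (rearr volume f) volPos := (rearr_antitone volume f).measurable.aemeasurable
  have hm : AEMeasurable (fun x => rearr volume f (radial n x)) volume := hr.comp_quasiMeasurePreserving hT.quasiMeasurePreserving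
  have he : ∀ t, rearr volume (fun x => rearr volume f (radial n x)) t = rearr volume f t := fun t => by
    rw [rearr_comp hT hr, rearr_rearr]
  exact le_antisymm (hρ.rearr_mono _ _ hm hf fun t _ => (he t).le)
    (hρ.rearr_mono _ _ hf hm fun t _ => (he t).ge)

/-- The class `B_n(∞)` of functions `Φ : (0,∞) → (0,∞)`. -/
structure ClassB (n : ℕ) (Φ : ℝ → ℝ) : Prop where
  pos : ∀ r, 0 < r → 0 < Φ r
  anti : AntitoneOn Φ (Ioi 0)
  cont : ContinuousOn Φ (Ioi 0)
  lintegral_le : ∃ C : ℝ, 0 < C ∧ ∀ r, 0 < r →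
    ∫⁻ s in Ioo 0 r, ENNReal.ofReal (Φ s * s ^ (n - 1)) ≤ ENNReal.ofReal (C * (Φ r * r ^ n))

/-- The class `D(∞)` of functions `Φ : (0,∞) → (0,∞)`, on `ℝ^n`. -/
structure ClassD (n : ℕ) (Φ : ℝ → ℝ) : Prop where
  pos : ∀ r, 0 < r → 0 < Φ r
  lintegral_le : ∃ C : ℝ, 0 < C ∧ ∀ r, 0 < r →
    ∫⁻ s in Ioo 0 (r ^ n), ENNReal.ofReal (1 / (Φ (s ^ (1 / (n : ℝ))) * s)) ≤ ENNReal.ofReal (C / Φ r)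

/-- The generalized fractional maximal function `M_Φ f`, with values in `[0,∞]`. -/
noncomputable def maximal (n : ℕ) (Φ : ℝ → ℝ) (f : Rn n → ℂ) (x : Rn n) : ℝ≥0∞ :=
  ⨆ (r : ℝ) (_ : 0 < r), ENNReal.ofReal (Φ r) * ∫⁻ y in Metric.ball x r, ‖f y‖ₑ

/-- The space `M_E^Φ = {M_Φ f : f ∈ E}`, where `E` is given by its functional norm. -/
def maxSpace (n : ℕ) (Φ : ℝ → ℝ) (ρE : (Rn n → ℝ≥0∞) → ℝ≥0∞) : Set (Rn n → ℝ≥0∞) :=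
  {u | ∃ f ∈ space volume ρE, maximal n Φ f = u}

/-- `‖u‖_{M_E^Φ} = inf {‖f‖_E : f ∈ E, M_Φ f = u}`. -/
noncomputable def maxNorm (n : ℕ) (Φ : ℝ → ℝ) (ρE : (Rn n → ℝ≥0∞) → ℝ≥0∞) (u : Rn n → ℝ≥0∞) :
    ℝ≥0∞ :=
  ⨅ (f : Rn n → ℂ) (_ : f ∈ space volume ρE ∧ maximal n Φ f = u), ρE (fun x => ‖f x‖ₑ)

/-- The set inclusion `M_E^Φ ⊂ X`. -/
def MaxSubset (n : ℕ) (Φ : ℝ → ℝ) (ρE ρX : (Rn n → ℝ≥0∞) → ℝ≥0∞) : Prop :=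
  ∀ u ∈ maxSpace n Φ ρE, MemSpace volume ρX u

/-- The bounded embedding of `M_E^Φ` into `X`: inclusion together with a norm estimate. -/
def MaxEmbeds (n : ℕ) (Φ : ℝ → ℝ) (ρE ρX : (Rn n → ℝ≥0∞) → ℝ≥0∞) : Prop :=
  (∀ u ∈ maxSpace n Φ ρE, MemSpace volume ρX u) ∧
    ∃ C : ℝ≥0, 0 < C ∧ ∀ u ∈ maxSpace n Φ ρE, ρX u ≤ C * maxNorm n Φ ρE u

/-- A set of `[0,∞]`-valued functions on `ℝ_+`, with a functional on it. Functions on `ℝ_+` are written as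
functions on `ℝ` whose values outside `ℝ_+` play no role. -/
structure Cone where
  carrier : Set (ℝ → ℝ≥0∞)
  gauge : (ℝ → ℝ≥0∞) → ℝ≥0∞

/-- The cone `{h : h = T u on ℝ_+, u ∈ S}` of measurable functions with the functional
`h ↦ inf {N u : u ∈ S, T u = h on ℝ_+}`. -/
noncomputable def imageCone {U : Type*} (S : Set U) (N : U → ℝ≥0∞) (T : U → ℝ → ℝ≥0∞) : Cone where
  carrier := {h | AEMeasurable h volPos ∧ ∃ u ∈ S, ∀ t, 0 < t → h t = T u t}
  gauge h := ⨅ (u : U) (_ : u ∈ S ∧ ∀ t, 0 < t → h t = T u t), N u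

/-- The embedding `K ↦ X~` of a cone into the space on `ℝ_+` with the functional norm `ρ`. -/
def Cone.Embeds (K : Cone) (ρ : (ℝ → ℝ≥0∞) → ℝ≥0∞) : Prop :=
  (∀ h ∈ K.carrier, MemSpace volPos ρ h) ∧
    ∃ C : ℝ≥0, 0 < C ∧ ∀ h ∈ K.carrier, ρ h ≤ C * K.gauge h

/-- The cone of the functions `u^*`, `u ∈ M_E^Φ`. -/
noncomputable def cone₁ (n : ℕ) (Φ : ℝ → ℝ) (ρE : (Rn n → ℝ≥0∞) → ℝ≥0∞) : Cone :=
  imageCone (maxSpace n Φ ρE) (maxNorm n Φ ρE) (fun u => rearr volume u)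

/-- The cone of the functions `u^{**}`, `u ∈ M_E^Φ`. -/
noncomputable def cone₂ (n : ℕ) (Φ : ℝ → ℝ) (ρE : (Rn n → ℝ≥0∞) → ℝ≥0∞) : Cone :=
  imageCone (maxSpace n Φ ρE) (maxNorm n Φ ρE) (fun u => rearrAvg volume u)

/-- The cone of the functions `t ↦ sup_{τ > t} τ Φ(τ^{1/n}) u^{**}(τ)`, `u ∈ E`. -/
noncomputable def cone₃ (n : ℕ) (Φ : ℝ → ℝ) (ρE : (Rn n → ℝ≥0∞) → ℝ≥0∞) : Cone :=
  imageCone (space volume ρE) (fun u => ρE (fun x => ‖u x‖ₑ)) (fun u t =>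
    ⨆ (τ : ℝ) (_ : t < τ),
      ENNReal.ofReal (τ * Φ (τ ^ (1 / (n : ℝ)))) * rearrAvg volume (fun x => ‖u x‖ₑ) τ)

/-- The cone of the functions `t ↦ t Φ(t^{1/n}) u^{**}(t) + sup_{τ > t} τ Φ(τ^{1/n}) u^*(τ)`, `u ∈ E`. -/
noncomputable def cone₄ (n : ℕ) (Φ : ℝ → ℝ) (ρE : (Rn n → ℝ≥0∞) → ℝ≥0∞) : Cone :=
  imageCone (space volume ρE) (fun u => ρE (fun x => ‖u x‖ₑ)) (fun u t =>
    ENNReal.ofReal (t * Φ (t ^ (1 / (n : ℝ)))) * rearrAvg volume (fun x => ‖u x‖ₑ) t +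
      ⨆ (τ : ℝ) (_ : t < τ),
        ENNReal.ofReal (τ * Φ (τ ^ (1 / (n : ℝ)))) * rearr volume (fun x => ‖u x‖ₑ) τ)

end FracMax

/-! Write `φ(t) = Φ(t^{1/n})` and `H_f(t) = sup_{τ>t} φ(τ) ∫_0^τ f^*` (`supAvg`). Everything reduces
to a comparison of `(M_Φ f)^*` with `H_f`.

Upper bound: `(M_Φ f)^* ≤ K H_f` for every `f` (`exists_rearr_maxFn_le_supAvg`). Balls of volume at
least `t` are controlled pointwise by Hardy–Littlewood. Smaller balls are handled by truncating `f`
at height `f^*(t)` and applying a Vitali covering estimate to the remaining part.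

Lower bound: `H_f ≤ K (M_Φ F)^*`, where `F(x) = f^*(v_n |x|^n)` (`exists_supAvg_le_rearr_maxFn`). It
can only be expected for a radial rearrangement, but this suffices, because `F` has the same norm in
`E` as `f`.

The third cone consists of the functions `H_f` themselves. The condition `B_n(∞)` makes `φ` doubling
and makes the average of `H_f` over `(0,t)` at most a multiple of `H_f(t)`
(`IsWeight.lintegral_supAvg_le`), so passing from `u^*` to `u^{**}` costs a constant. Under `D(∞)`
the function defining the fourth cone is comparable with `H_f` (`IsWeight.supAvg_le_avgAddSup`).

The bare inclusion already gives a norm bound by a condensation argument: a sequence violating every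
bound can be summed into one function of `E` whose maximal function is not in `X`
(`MaxSubset.exists_bound`). -/

namespace FracMax

/-! ### Rearrangements, averages and the Hardy–Littlewood inequality -/

section Rearrangement

variable {α β : Type*} [MeasurableSpace α] [MeasurableSpace β] {μ : Measure α} {ν : Measure β}

/-- If `f` is finite almost everywhere, this is the layer-cake formula for its real part `(f
x).toReal`. Otherwise the set `f = ∞` lies in every superlevel set and both sides are infinite. -/
theorem lintegral_eq_lintegral_meas_ofReal_lt {f : α → ℝ≥0∞} (hf : AEMeasurable f μ) :
    ∫⁻ x, f x ∂μ = ∫⁻ y in Ioi (0 : ℝ), μ {x | ENNReal.ofReal y < f x} := by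
  by_cases h : μ {x | f x = ∞} = 0
  · have hfin : ∀ᵐ x ∂μ, f x ≠ ∞ := by
      rw [ae_iff]; simpa using h
    have h1 : ∫⁻ x, f x ∂μ = ∫⁻ x, ENNReal.ofReal (f x).toReal ∂μ :=
      lintegral_congr_ae (hfin.mono fun x hx => (ENNReal.ofReal_toReal hx).symm)
    rw [h1, lintegral_eq_lintegral_meas_lt μ (Eventually.of_forall fun _ => ENNReal.toReal_nonneg)
      hf.ennreal_toReal]
    refine setLIntegral_congr_fun measurableSet_Ioi fun y hy => measure_congr ?_
    filter_upwards [hfin] with x hx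
    exact propext (ENNReal.ofReal_lt_iff_lt_toReal (le_of_lt hy) hx).symm
  · have h1 : ∫⁻ x, f x ∂μ = ∞ := lintegral_eq_top_of_measure_eq_top_ne_zero hf h
    rw [h1, eq_comm, eq_top_iff]
    calc (∞ : ℝ≥0∞) = ∫⁻ _ in Ioi (0 : ℝ), μ {x | f x = ∞} := by
          rw [setLIntegral_const, Real.volume_Ioi, ENNReal.mul_top h]
      _ ≤ _ := lintegral_mono fun y => measure_mono fun x (hx : f x = ∞) => by
          simp [hx]

theorem lintegral_le_of_meas_lt_le {f : α → ℝ≥0∞} {g : β → ℝ≥0∞} (hf : AEMeasurable f μ)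
    (hg : AEMeasurable g ν) (h : ∀ y, μ {x | y < f x} ≤ ν {x | y < g x}) :
    ∫⁻ x, f x ∂μ ≤ ∫⁻ x, g x ∂ν := by
  rw [lintegral_eq_lintegral_meas_ofReal_lt hf, lintegral_eq_lintegral_meas_ofReal_lt hg]
  exact lintegral_mono fun y => h _

/-- The Hardy–Littlewood inequality for the integral over a set. -/
theorem setLIntegral_le_lintegral_rearr {f : α → ℝ≥0∞} (hf : AEMeasurable f μ) {A : Set α} {τ : ℝ}
    (hA : μ A ≤ ENNReal.ofReal τ) :
    ∫⁻ x in A, f x ∂μ ≤ ∫⁻ s in Ioo 0 τ, rearr μ f s := by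
  refine lintegral_le_of_meas_lt_le hf.restrict (rearr_antitone μ f).measurable.aemeasurable
    fun y => ?_
  have hm : MeasurableSet {s | y < rearr μ f s} :=
    measurableSet_lt measurable_const (rearr_antitone μ f).measurable
  rw [Measure.restrict_apply hm]
  have h1 : (μ.restrict A) {x | y < f x} ≤ ENNReal.ofReal τ :=
    (measure_mono (subset_univ _)).trans (by simpa using hA)
  have h2 : (μ.restrict A) {x | y < f x} ≤ μ {x | y < f x} := Measure.restrict_le_self _
  -- The superlevel set of `f^*` inside `(0,τ)` contains `(0,m)`: `s < m` forces `y < f^*(s)`, and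
  -- `m ≤ τ` because `m ≤ μ A`.
  set m := (μ.restrict A) {x | y < f x}
  have hmt : m ≠ ∞ := (h1.trans_lt ENNReal.ofReal_lt_top).ne
  calc m = volume (Ioo 0 m.toReal) := by
        rw [Real.volume_Ioo, sub_zero, ENNReal.ofReal_toReal hmt]
    _ ≤ _ := measure_mono fun s hs => by
        have hs' : ENNReal.ofReal s < m := (ENNReal.ofReal_lt_iff_lt_toReal hs.1.le hmt).2 hs.2
        refine ⟨?_, hs.1, ?_⟩
        · rw [mem_ofPred_eq, lt_rearr_iff]
          exact hs'.trans_le h2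
        · by_contra! h
          exact absurd (h1.trans (ENNReal.ofReal_le_ofReal h)) (not_le.2 hs')

theorem rearr_le_iff {f : α → ℝ≥0∞} {t : ℝ} {y : ℝ≥0∞} :
    rearr μ f t ≤ y ↔ μ {x | y < f x} ≤ ENNReal.ofReal t := by
  rw [← not_lt, lt_rearr_iff, not_lt]

theorem ofReal_mul_rearr_le (f : α → ℝ≥0∞) (t : ℝ) :
    ENNReal.ofReal t * rearr μ f t ≤ ∫⁻ s in Ioo 0 t, rearr μ f s := by
  calc ENNReal.ofReal t * rearr μ f t = ∫⁻ _ in Ioo 0 t, rearr μ f t := by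
        rw [setLIntegral_const, Real.volume_Ioo, sub_zero, mul_comm]
    _ ≤ _ := setLIntegral_mono' measurableSet_Ioo fun s hs => rearr_antitone μ f hs.2.le

theorem rearr_le_rearrAvg (f : α → ℝ≥0∞) {t : ℝ} (ht : 0 < t) :
    rearr μ f t ≤ rearrAvg μ f t := by
  have h0 : ENNReal.ofReal t ≠ 0 := by simpa using ht
  rw [rearrAvg, ← one_mul (rearr μ f t), ← ENNReal.inv_mul_cancel h0 ENNReal.ofReal_ne_top,
    mul_assoc]
  gcongr
  exact ofReal_mul_rearr_le f t

/-- With `c = φ(t)` the factor `t` cancels the average, which brings the expressions defining the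
cones into the form `φ(t) ∫_0^t f^*`. -/
theorem ofReal_mul_rearrAvg (f : α → ℝ≥0∞) {t c : ℝ} (ht : 0 < t) :
    ENNReal.ofReal (t * c) * rearrAvg μ f t = ENNReal.ofReal c * ∫⁻ s in Ioo 0 t, rearr μ f s := by
  have h0 : ENNReal.ofReal t ≠ 0 := by simpa using ht
  rw [rearrAvg, ENNReal.ofReal_mul ht.le, mul_comm (ENNReal.ofReal t), mul_assoc, ← mul_assoc _ _⁻¹,
    ENNReal.mul_inv_cancel h0 ENNReal.ofReal_ne_top, one_mul]

end Rearrangement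

/-! The weight `τ ↦ Φ(τ^{1/n})`. -/

/-- The substitution `s = σ^n` reduces this to the integral condition of `B_n(∞)`; the Jacobian `n
σ^{n-1}` supplies the weight and the extra factor `n`. -/
theorem ClassB.setLIntegral_rpow_le {n : ℕ} (hn : 1 ≤ n) {Φ : ℝ → ℝ} (hB : ClassB n Φ) :
    ∃ C : ℝ, 0 < C ∧ ∀ t, 0 < t → ∫⁻ s in Ioo 0 t, ENNReal.ofReal (Φ (s ^ (1 / (n : ℝ)))) ≤
      ENNReal.ofReal (C * (t * Φ (t ^ (1 / (n : ℝ))))) := by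
  obtain ⟨C, hC, h⟩ := hB.lintegral_le
  have hn0 : n ≠ 0 := by omega
  refine ⟨n * C, by positivity, fun t ht => ?_⟩
  set r := t ^ (1 / (n : ℝ)) with hr
  have hr0 : 0 < r := by positivity
  have hrn : r ^ n = t := by rw [hr, one_div]; exact Real.rpow_inv_natCast_pow ht.le hn0
  have himg : (fun s : ℝ => s ^ n) '' Ioo 0 r = Ioo 0 t := by
    ext s
    constructor
    · rintro ⟨a, ha, rfl⟩
      exact ⟨pow_pos ha.1 _, hrn ▸ pow_lt_pow_left₀ ha.2 ha.1.le hn0⟩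
    · rintro ⟨h0, h1⟩
      refine ⟨s ^ (1 / (n : ℝ)), ⟨by positivity, ?_⟩, ?_⟩
      · exact Real.rpow_lt_rpow h0.le h1 (by positivity)
      · simp only [one_div]
        exact Real.rpow_inv_natCast_pow h0.le hn0
  rw [← himg, lintegral_image_eq_lintegral_abs_deriv_mul (f' := fun s => n * s ^ (n - 1))
    measurableSet_Ioo (fun x _ => (hasDerivAt_pow n x).hasDerivWithinAt)
    (fun a ha b hb hab => (pow_left_inj₀ ha.1.le hb.1.le hn0).1 hab)]
  calc _ = ∫⁻ s in Ioo 0 r, ENNReal.ofReal n * ENNReal.ofReal (Φ s * s ^ (n - 1)) := by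
        refine setLIntegral_congr_fun measurableSet_Ioo fun s hs => ?_
        have h0 : 0 < s := hs.1
        have hs1 : (s ^ n) ^ (1 / (n : ℝ)) = s := by
          rw [one_div]; exact Real.pow_rpow_inv_natCast h0.le hn0
        simp only [hs1]
        rw [← ENNReal.ofReal_mul (by positivity), ← ENNReal.ofReal_mul (by positivity),
          abs_of_nonneg (by positivity)]
        ring_nf
    _ ≤ _ := by
        rw [lintegral_const_mul' _ _ ENNReal.ofReal_ne_top, mul_assoc (n : ℝ),
          ENNReal.ofReal_mul (by positivity)]
        gcongr
        rw [← hrn, mul_comm (r ^ n)]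
        exact h r hr0

/-- Positive non-increasing weights on `(0,∞)` whose averages over `(0,t)` are bounded by a multiple of
their value at `t`. -/
structure IsWeight (φ : ℝ → ℝ) (C : ℝ) : Prop where
  pos : ∀ t, 0 < t → 0 < φ t
  anti : ∀ s t, 0 < s → s ≤ t → φ t ≤ φ s
  one_le : 1 ≤ C
  lintegral_le : ∀ t, 0 < t →
    ∫⁻ s in Ioo 0 t, ENNReal.ofReal (φ s) ≤ ENNReal.ofReal (C * (t * φ t))

theorem ClassB.isWeight {n : ℕ} (hn : 1 ≤ n) {Φ : ℝ → ℝ} (hB : ClassB n Φ) :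
    ∃ C, IsWeight (fun t => Φ (t ^ (1 / (n : ℝ)))) C := by
  obtain ⟨C, hC, h⟩ := hB.setLIntegral_rpow_le hn
  refine ⟨max C 1, fun t ht => hB.pos _ (by positivity), fun s t hs hst => ?_, le_max_right _ _,
    fun t ht => (h t ht).trans (ENNReal.ofReal_le_ofReal ?_)⟩
  · have ht := hs.trans_le hst
    exact hB.anti (mem_Ioi.2 (by positivity)) (mem_Ioi.2 (by positivity))
      (Real.rpow_le_rpow hs.le hst (by positivity))
  · have := hB.pos (t ^ (1 / (n : ℝ))) (by positivity)
    gcongr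
    exact le_max_left _ _

/-- By monotonicity `s φ(s) ≤ ∫_0^s φ ≤ ∫_0^t φ`, and the last integral is at most `C t φ(t)`. This
is the source of all doubling estimates for `φ`. -/
theorem IsWeight.mul_le {φ : ℝ → ℝ} {C : ℝ} (h : IsWeight φ C) {s t : ℝ} (hs : 0 < s) (hst : s ≤ t) :
    s * φ s ≤ C * (t * φ t) := by
  have ht := hs.trans_le hst
  have hφ := h.pos s hs
  have hφt := h.pos t ht
  have hC := zero_lt_one.trans_le h.one_le
  rw [← ENNReal.ofReal_le_ofReal_iff (by positivity)]
  calc ENNReal.ofReal (s * φ s) = ∫⁻ _ in Ioo 0 s, ENNReal.ofReal (φ s) := by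
        rw [setLIntegral_const, Real.volume_Ioo, sub_zero, ENNReal.ofReal_mul hs.le, mul_comm]
    _ ≤ ∫⁻ σ in Ioo 0 s, ENNReal.ofReal (φ σ) :=
        setLIntegral_mono' measurableSet_Ioo fun σ hσ =>
          ENNReal.ofReal_le_ofReal (h.anti _ _ hσ.1 hσ.2.le)
    _ ≤ ∫⁻ σ in Ioo 0 t, ENNReal.ofReal (φ σ) := lintegral_mono_set (Ioo_subset_Ioo_right hst)
    _ ≤ _ := h.lintegral_le t ht

/-- `sup_{τ > t} φ(τ) ∫_0^τ g`. -/
noncomputable def supAvg (φ : ℝ → ℝ) (g : ℝ → ℝ≥0∞) (t : ℝ) : ℝ≥0∞ :=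
  ⨆ (τ : ℝ) (_ : t < τ), ENNReal.ofReal (φ τ) * ∫⁻ s in Ioo 0 τ, g s

theorem le_supAvg (φ : ℝ → ℝ) (g : ℝ → ℝ≥0∞) {t τ : ℝ} (h : t < τ) :
    ENNReal.ofReal (φ τ) * ∫⁻ s in Ioo 0 τ, g s ≤ supAvg φ g t :=
  le_iSup₂ (f := fun (τ : ℝ) (_ : t < τ) => ENNReal.ofReal (φ τ) * ∫⁻ s in Ioo 0 τ, g s) τ h

theorem supAvg_antitone (φ : ℝ → ℝ) (g : ℝ → ℝ≥0∞) : Antitone (supAvg φ g) := fun _ _ hst =>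
  iSup₂_le fun _ hτ => le_supAvg φ g (hst.trans_lt hτ)

/-- The supremum runs over `τ > t` strictly, so `τ = t` is not admissible. Doubling, `φ(t) ≤ 2C
φ(2t)`, replaces it by `τ = 2t`. -/
theorem IsWeight.mul_lintegral_le_supAvg {φ : ℝ → ℝ} {C : ℝ} (h : IsWeight φ C) (g : ℝ → ℝ≥0∞)
    {t : ℝ} (ht : 0 < t) :
    ENNReal.ofReal (φ t) * ∫⁻ s in Ioo 0 t, g s ≤ ENNReal.ofReal (2 * C) * supAvg φ g t := by
  have hφ : φ t ≤ 2 * C * φ (2 * t) := by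
    have := h.mul_le ht (show t ≤ 2 * t by linarith)
    refine le_of_mul_le_mul_left ?_ ht
    linarith
  have hC := h.one_le
  calc _ ≤ ENNReal.ofReal (2 * C * φ (2 * t)) * ∫⁻ s in Ioo 0 (2 * t), g s := by
        gcongr
        linarith
    _ = ENNReal.ofReal (2 * C) * (ENNReal.ofReal (φ (2 * t)) * ∫⁻ s in Ioo 0 (2 * t), g s) := by
        rw [ENNReal.ofReal_mul (by positivity), mul_assoc]
    _ ≤ _ := by
        gcongr
        exact le_supAvg φ g (by linarith)

/-- For `s < t`, the terms with `σ > t` are bounded by the supremum at `t`, and those with `s < σ ≤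
t` by `φ(s) ∫_0^t g`. Integrating `φ(s)` over `(0,t)` gives `C t φ(t)`, which leads back to the
supremum at `t`. -/
theorem IsWeight.lintegral_supAvg_le {φ : ℝ → ℝ} {C : ℝ} (h : IsWeight φ C) (g : ℝ → ℝ≥0∞)
    {t : ℝ} (ht : 0 < t) :
    ∫⁻ s in Ioo 0 t, supAvg φ g s ≤ ENNReal.ofReal (1 + 2 * C ^ 2) * (ENNReal.ofReal t * supAvg φ g t) := by
  have hC := zero_lt_one.trans_le h.one_le
  set I := ∫⁻ s in Ioo 0 t, g s with hI
  have key : ∀ s ∈ Ioo 0 t, supAvg φ g s ≤ supAvg φ g t + ENNReal.ofReal (φ s) * I := by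
    intro s hs
    refine iSup₂_le fun σ hσ => ?_
    rcases lt_or_ge t σ with hlt | hle
    · exact (le_supAvg φ g hlt).trans le_self_add
    · refine le_trans ?_ le_add_self
      gcongr
      · exact h.anti _ _ hs.1 hσ.le
      · exact lintegral_mono_set (Ioo_subset_Ioo_right hle)
  have hm : AEMeasurable (fun s => ENNReal.ofReal (φ s)) (volume.restrict (Ioo 0 t)) := by
    refine ENNReal.measurable_ofReal.comp_aemeasurable ?_
    refine aemeasurable_restrict_of_antitoneOn measurableSet_Ioo fun a ha b hb hab => ?_
    exact h.anti _ _ ha.1 hab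
  calc _ ≤ ∫⁻ s in Ioo 0 t, (supAvg φ g t + ENNReal.ofReal (φ s) * I) :=
        setLIntegral_mono' measurableSet_Ioo key
    _ = supAvg φ g t * ENNReal.ofReal t + (∫⁻ s in Ioo 0 t, ENNReal.ofReal (φ s)) * I := by
        rw [lintegral_add_left measurable_const, setLIntegral_const, Real.volume_Ioo, sub_zero,
          lintegral_mul_const'' _ hm]
    _ ≤ supAvg φ g t * ENNReal.ofReal t + ENNReal.ofReal (C * (t * φ t)) * I := by
        gcongr
        exact h.lintegral_le t ht
    _ = supAvg φ g t * ENNReal.ofReal t +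
        ENNReal.ofReal C * ENNReal.ofReal t * (ENNReal.ofReal (φ t) * I) := by
        rw [ENNReal.ofReal_mul hC.le, ENNReal.ofReal_mul ht.le]
        ring
    _ ≤ supAvg φ g t * ENNReal.ofReal t +
        ENNReal.ofReal C * ENNReal.ofReal t * (ENNReal.ofReal (2 * C) * supAvg φ g t) := by
        exact add_le_add le_rfl (mul_le_mul' le_rfl (h.mul_lintegral_le_supAvg g ht))
    _ = _ := by
        rw [show 1 + 2 * C ^ 2 = 1 + C * (2 * C) by ring,
          ENNReal.ofReal_add (by positivity) (by positivity), ENNReal.ofReal_mul hC.le,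
          ENNReal.ofReal_one]
        ring

/-- Needed to pass between `r^n` and the volume `v_n r^n` of a ball. For `a ≤ 1` monotonicity is
enough, for `a ≥ 1` doubling is used; `max a 1` treats both at once. -/
theorem IsWeight.exists_le_mul {φ : ℝ → ℝ} {C : ℝ} (h : IsWeight φ C) {a : ℝ} (ha : 0 < a) :
    ∃ K : ℝ, 0 < K ∧ ∀ τ, 0 < τ → φ τ ≤ K * φ (a * τ) := by
  have hC := zero_lt_one.trans_le h.one_le
  refine ⟨C * max a 1, by positivity, fun τ hτ => ?_⟩
  have h1 := h.mul_le hτ (show τ ≤ max a 1 * τ from le_mul_of_one_le_left hτ.le (le_max_right _ _))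
  have h2 : φ (max a 1 * τ) ≤ φ (a * τ) :=
    h.anti _ _ (by positivity) (by gcongr; exact le_max_left _ _)
  refine le_of_mul_le_mul_left (h1.trans ?_) hτ
  calc C * (max a 1 * τ * φ (max a 1 * τ)) ≤ C * (max a 1 * τ * φ (a * τ)) := by gcongr
    _ = _ := by ring

/-! ### Two-sided estimates for the rearranged maximal function -/

/-- The generalized fractional maximal function of a `[0,∞]`-valued function. -/
noncomputable def maxFn (n : ℕ) (Φ : ℝ → ℝ) (g : Rn n → ℝ≥0∞) (x : Rn n) : ℝ≥0∞ :=
  ⨆ (r : ℝ) (_ : 0 < r), ENNReal.ofReal (Φ r) * ∫⁻ y in Metric.ball x r, g y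

theorem maximal_eq_maxFn (n : ℕ) (Φ : ℝ → ℝ) (f : Rn n → ℂ) :
    maximal n Φ f = maxFn n Φ (fun x => ‖f x‖ₑ) := rfl

theorem le_maxFn {n : ℕ} (Φ : ℝ → ℝ) (g : Rn n → ℝ≥0∞) (x : Rn n) {r : ℝ} (hr : 0 < r) :
    ENNReal.ofReal (Φ r) * ∫⁻ y in Metric.ball x r, g y ≤ maxFn n Φ g x :=
  le_iSup₂ (f := fun (r : ℝ) (_ : 0 < r) => ENNReal.ofReal (Φ r) * ∫⁻ y in Metric.ball x r, g y) r hr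

theorem maxFn_mono {n : ℕ} (Φ : ℝ → ℝ) {g h : Rn n → ℝ≥0∞} (hgh : g ≤ᵐ[volume] h) (x : Rn n) :
    maxFn n Φ g x ≤ maxFn n Φ h x :=
  iSup₂_mono fun _ _ => mul_le_mul' le_rfl (lintegral_mono_ae (ae_restrict_of_ae hgh))

theorem maxFn_congr_ae {n : ℕ} (Φ : ℝ → ℝ) {g h : Rn n → ℝ≥0∞} (hgh : g =ᵐ[volume] h) :
    maxFn n Φ g = maxFn n Φ h :=
  funext fun x => le_antisymm (maxFn_mono Φ hgh.le x) (maxFn_mono Φ hgh.symm.le x)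

theorem maxFn_const_mul {n : ℕ} (Φ : ℝ → ℝ) (g : Rn n → ℝ≥0∞) {a : ℝ≥0∞} (ha : a ≠ ∞) (x : Rn n) :
    maxFn n Φ (fun y => a * g y) x = a * maxFn n Φ g x := by
  simp only [maxFn, ENNReal.mul_iSup, lintegral_const_mul' _ _ ha]
  simp only [mul_left_comm]

/-- Superlevel sets are open. If the integral over `B(x,r)` is large enough, so is the one over a
slightly smaller concentric ball, by continuity from below; that ball lies in `B(z,r)` for all `z`
near `x`. -/
theorem measurable_maxFn {n : ℕ} (Φ : ℝ → ℝ) (g : Rn n → ℝ≥0∞) : Measurable (maxFn n Φ g) := by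
  refine measurable_of_Ioi fun a => IsOpen.measurableSet ?_
  rw [Metric.isOpen_iff]
  intro x hx
  obtain ⟨r, hr⟩ := lt_iSup_iff.1 (show a < maxFn n Φ g x from hx)
  obtain ⟨hr0, hr⟩ := lt_iSup_iff.1 hr
  have hU : Metric.ball x r = ⋃ k : ℕ, Metric.ball x (r - 1 / ((k : ℝ) + 1)) := by
    ext y
    simp only [Metric.mem_ball, mem_iUnion]
    constructor
    · intro h
      obtain ⟨k, hk⟩ := exists_nat_one_div_lt (sub_pos.2 h)
      exact ⟨k, by linarith⟩
    · rintro ⟨k, hk⟩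
      have : 0 < 1 / ((k : ℝ) + 1) := Nat.one_div_pos_of_nat
      linarith
  have hmono : Monotone fun k : ℕ => Metric.ball x (r - 1 / ((k : ℝ) + 1)) := fun i j hij =>
    Metric.ball_subset_ball (sub_le_sub_left (Nat.one_div_le_one_div hij) _)
  rw [hU, setLIntegral_iUnion_of_directed g hmono.directed_le, ENNReal.mul_iSup] at hr
  obtain ⟨k, hk⟩ := lt_iSup_iff.1 hr
  refine ⟨1 / ((k : ℝ) + 1), Nat.one_div_pos_of_nat, fun z hz => ?_⟩
  change a < maxFn n Φ g z
  refine hk.trans_le (le_trans ?_ (le_maxFn Φ g z hr0))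
  gcongr
  refine Metric.ball_subset_ball' ?_
  have : dist x z < 1 / ((k : ℝ) + 1) := Metric.mem_ball'.1 hz
  linarith

theorem volume_ball_toReal_pos {n : ℕ} (hn : 1 ≤ n) :
    0 < (volume (Metric.ball (0 : Rn n) 1)).toReal :=
  have : Nonempty (Fin n) := ⟨⟨0, hn⟩⟩
  ENNReal.toReal_pos (Metric.measure_ball_pos _ _ one_pos).ne' measure_ball_lt_top.ne

theorem volume_ball_eq {n : ℕ} (hn : 1 ≤ n) (x : Rn n) {r : ℝ} (hr : 0 ≤ r) :
    volume (Metric.ball x r) =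
      ENNReal.ofReal ((volume (Metric.ball (0 : Rn n) 1)).toReal * r ^ n) := by
  have : Nonempty (Fin n) := ⟨⟨0, hn⟩⟩
  rw [Measure.addHaar_ball _ _ hr, finrank_euclideanSpace_fin, mul_comm,
    ENNReal.ofReal_mul ENNReal.toReal_nonneg, ENNReal.ofReal_toReal measure_ball_lt_top.ne]

theorem volume_closedBall_eq {n : ℕ} (x : Rn n) {r : ℝ} (hr : 0 ≤ r) :
    volume (Metric.closedBall x r) =
      ENNReal.ofReal ((volume (Metric.ball (0 : Rn n) 1)).toReal * r ^ n) := by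
  rw [Measure.addHaar_closedBall _ _ hr, finrank_euclideanSpace_fin, mul_comm,
    ENNReal.ofReal_mul ENNReal.toReal_nonneg, ENNReal.ofReal_toReal measure_ball_lt_top.ne]

/-- For `|x| < R` the ball `B(x,2R)` contains `B(0,R)`, and the integral over `B(0,R)` is the one
over `(0,τ)` since `radial` preserves measure. -/
theorem lintegral_Ioo_le_lintegral_ball {n : ℕ} (hn : 1 ≤ n) {g : ℝ → ℝ≥0∞} (hg : Measurable g)
    {τ R : ℝ} (hR : 0 < R) (hτ : (volume (Metric.ball (0 : Rn n) 1)).toReal * R ^ n = τ) {x : Rn n}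
    (hx : radial n x < τ) :
    ∫⁻ s in Ioo 0 τ, g s ≤ ∫⁻ y in Metric.ball x (2 * R), g (radial n y) := by
  have hT := radial_measurePreserving n hn
  have hv := volume_ball_toReal_pos hn
  have hnorm : ∀ y : Rn n, radial n y < τ → ‖y‖ < R := by
    intro y hy
    rw [radial, ← hτ] at hy
    exact lt_of_pow_lt_pow_left₀ n hR.le (lt_of_mul_lt_mul_left hy hv.le)
  calc ∫⁻ s in Ioo 0 τ, g s = ∫⁻ s in Iio τ, g s ∂volPos := by
        rw [Measure.restrict_restrict measurableSet_Iio, inter_comm, Ioi_inter_Iio]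
    _ = ∫⁻ y in radial n ⁻¹' Iio τ, g (radial n y) :=
        (hT.setLIntegral_comp_preimage measurableSet_Iio hg).symm
    _ ≤ _ := by
        refine lintegral_mono_set fun y hy => ?_
        rw [Metric.mem_ball, dist_eq_norm]
        linarith [norm_sub_le y x, hnorm y hy, hnorm x hx]

/-- The maximal function of a function of `v_n |x|^n` is bounded from below. -/
theorem exists_supAvg_le_rearr_maxFn {n : ℕ} (hn : 1 ≤ n) {Φ : ℝ → ℝ} (hB : ClassB n Φ) :
    ∃ K : ℝ≥0, 0 < K ∧ ∀ (g : ℝ → ℝ≥0∞), Measurable g → ∀ t, 0 < t →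
      supAvg (fun s => Φ (s ^ (1 / (n : ℝ)))) g t ≤
        K * rearr volume (maxFn n Φ fun x => g (radial n x)) t := by
  obtain ⟨C, h⟩ := hB.isWeight hn
  have hn0 : n ≠ 0 := by omega
  have hT := radial_measurePreserving n hn
  have hv := volume_ball_toReal_pos hn
  set v := (volume (Metric.ball (0 : Rn n) 1)).toReal with hvdef
  -- The factor `2^n / v` is chosen so that `φ(2^n τ / v) = Φ(2R)` when `v R^n = τ`.
  obtain ⟨K, hK, hdbl⟩ := h.exists_le_mul (a := 2 ^ n / v) (by positivity)
  refine ⟨K.toNNReal, by simpa using hK, fun g hg t ht => iSup₂_le fun τ hτ => ?_⟩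
  have hτ0 := ht.trans hτ
  obtain ⟨R, hR, hRτ⟩ : ∃ R : ℝ, 0 < R ∧ R ^ n = τ / v :=
    ⟨(τ / v) ^ (1 / (n : ℝ)), by positivity, by
      rw [one_div]; exact Real.rpow_inv_natCast_pow (by positivity) hn0⟩
  have hRτ' : v * R ^ n = τ := by rw [hRτ]; field_simp
  have hΦ : (2 ^ n / v * τ) ^ (1 / (n : ℝ)) = 2 * R := by
    rw [one_div, ← hRτ', show 2 ^ n / v * (v * R ^ n) = (2 * R) ^ n by rw [mul_pow]; field_simp]
    exact Real.pow_rpow_inv_natCast (by positivity) hn0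
  have hd := hdbl τ hτ0
  simp only [hΦ] at hd
  calc _ ≤ ENNReal.ofReal (K * Φ (2 * R)) * ∫⁻ s in Ioo 0 τ, g s := by gcongr
    _ = ENNReal.ofReal K * (ENNReal.ofReal (Φ (2 * R)) * ∫⁻ s in Ioo 0 τ, g s) := by
        rw [ENNReal.ofReal_mul hK.le, mul_assoc]
    _ ≤ _ := mul_le_mul' le_rfl (le_of_forall_lt fun y hy => ?_)
  -- The maximal function exceeds `y` on the set `radial < τ`, whose measure `τ` is strictly larger
  -- than `t`.
  rw [lt_rearr_iff]
  calc ENNReal.ofReal t < ENNReal.ofReal τ := (ENNReal.ofReal_lt_ofReal_iff hτ0).2 hτ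
    _ = volume (radial n ⁻¹' Iio τ) := by
        rw [hT.measure_preimage measurableSet_Iio.nullMeasurableSet,
          Measure.restrict_apply measurableSet_Iio, inter_comm, Ioi_inter_Iio, Real.volume_Ioo,
          sub_zero]
    _ ≤ _ := measure_mono fun x hx => hy.trans_le <|
        le_trans (mul_le_mul' le_rfl (lintegral_Ioo_le_lintegral_ball hn hg hR hRτ' hx))
          (le_maxFn Φ _ x (by positivity))

/-- The weak type estimate for the maximal function over balls of measure less than `t`. -/
theorem volume_small_balls_le {n : ℕ} {t : ℝ} {Φ : ℝ → ℝ} {f : Rn n → ℝ≥0∞} {L b : ℝ≥0∞}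
    (hn : 1 ≤ n) (hL : L ≠ 0) (hL' : L ≠ ∞)
    (hb : ∀ r, 0 < r → (volume (Metric.ball (0 : Rn n) 1)).toReal * r ^ n < t →
      ENNReal.ofReal (Φ r) * ENNReal.ofReal ((volume (Metric.ball (0 : Rn n) 1)).toReal * r ^ n) ≤ b)
    (hf : b * ∫⁻ x, f x ≤ L * ENNReal.ofReal t) :
    volume {x | ∃ r, 0 < r ∧ (volume (Metric.ball (0 : Rn n) 1)).toReal * r ^ n < t ∧
      5 ^ n * L < ENNReal.ofReal (Φ r) * ∫⁻ y in Metric.ball x r, f y} ≤ ENNReal.ofReal t := by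
  have hv := volume_ball_toReal_pos hn
  set v := (volume (Metric.ball (0 : Rn n) 1)).toReal with hvdef
  let S : Set (Rn n × ℝ) := {p | 0 < p.2 ∧ v * p.2 ^ n < t ∧
      5 ^ n * L < ENNReal.ofReal (Φ p.2) * ∫⁻ y in Metric.ball p.1 p.2, f y}
  -- The covering lemma needs bounded radii; for `r ≥ 1` one has `r ≤ r^n < t / v`.
  have hR : ∀ p ∈ S, p.2 ≤ max 1 (t / v) := by
    intro p hp
    rcases le_total p.2 1 with h1 | h1
    · exact h1.trans (le_max_left _ _)
    · refine le_trans ?_ (le_max_right _ _)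
      rw [le_div_iff₀ hv, mul_comm]
      refine le_trans ?_ hp.2.1.le
      gcongr
      exact le_self_pow₀ h1 (by omega)
  obtain ⟨u, huS, hdisj, hcov⟩ := Vitali.exists_disjoint_subfamily_covering_enlargement_closedBall S
    (fun p => p.1) (fun p => p.2) _ hR 5 (by norm_num)
  have hdisj' : u.PairwiseDisjoint fun p => Metric.ball p.1 p.2 :=
    hdisj.mono_on fun p _ => Metric.ball_subset_closedBall
  have hcount : u.Countable := hdisj'.countable_of_isOpen (fun p _ => Metric.isOpen_ball)
    fun p hp => ⟨p.1, Metric.mem_ball_self (huS hp).1⟩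
  -- Enlarging a ball five times multiplies its volume by `5^n`, which the factor in the threshold
  -- `5^n L` absorbs; then `Φ(r) |B_r| ≤ b`.
  have hterm : ∀ p ∈ u, L * volume (Metric.closedBall p.1 (5 * p.2)) ≤
      b * ∫⁻ y in Metric.ball p.1 p.2, f y := by
    intro p hp
    obtain ⟨h0, h1, h2⟩ := huS hp
    rw [volume_closedBall_eq _ (by positivity), ← hvdef]
    calc L * ENNReal.ofReal (v * (5 * p.2) ^ n) = 5 ^ n * L * ENNReal.ofReal (v * p.2 ^ n) := by
          rw [show v * (5 * p.2) ^ n = 5 ^ n * (v * p.2 ^ n) by ring,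
            ENNReal.ofReal_mul (by positivity), ENNReal.ofReal_pow (by norm_num)]
          norm_num
          ring
      _ ≤ (ENNReal.ofReal (Φ p.2) * ∫⁻ y in Metric.ball p.1 p.2, f y) *
          ENNReal.ofReal (v * p.2 ^ n) := by gcongr
      _ = (ENNReal.ofReal (Φ p.2) * ENNReal.ofReal (v * p.2 ^ n)) *
          ∫⁻ y in Metric.ball p.1 p.2, f y := by ring
      _ ≤ _ := by
          gcongr
          exact hb _ h0 h1
  refine (ENNReal.mul_le_mul_iff_right hL hL').1 ?_
  calc _ ≤ L * volume (⋃ p ∈ u, Metric.closedBall p.1 (5 * p.2)) := by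
        gcongr
        rintro x ⟨r, h0, h1, h2⟩
        obtain ⟨q, hq, hsub⟩ := hcov (x, r) ⟨h0, h1, h2⟩
        exact mem_biUnion hq (hsub (Metric.mem_closedBall_self h0.le))
    _ ≤ L * ∑' p : u, volume (Metric.closedBall p.1.1 (5 * p.1.2)) := by
        gcongr
        exact measure_biUnion_le _ hcount _
    _ ≤ ∑' p : u, b * ∫⁻ y in Metric.ball p.1.1 p.1.2, f y := by
        rw [← ENNReal.tsum_mul_left]
        exact ENNReal.tsum_le_tsum fun p => hterm p.1 p.2
    _ = b * ∫⁻ y in ⋃ p ∈ u, Metric.ball p.1 p.2, f y := by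
        rw [ENNReal.tsum_mul_left,
          lintegral_biUnion hcount (fun _ _ => Metric.isOpen_ball.measurableSet) hdisj']
    _ ≤ b * ∫⁻ x, f x := by
        exact mul_le_mul' le_rfl (setLIntegral_le_lintegral _ _)
    _ ≤ _ := hf

/-- The rearrangement of the maximal function is bounded from above. -/
theorem exists_rearr_maxFn_le_supAvg {n : ℕ} (hn : 1 ≤ n) {Φ : ℝ → ℝ} (hB : ClassB n Φ) :
    ∃ K : ℝ≥0, 0 < K ∧ ∀ (f : Rn n → ℝ≥0∞), AEMeasurable f volume → ∀ t, 0 < t →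
      rearr volume (maxFn n Φ f) t ≤
        K * supAvg (fun s => Φ (s ^ (1 / (n : ℝ)))) (rearr volume f) t := by
  obtain ⟨C, h⟩ := hB.isWeight hn
  have hC1 := h.one_le
  have hC := zero_lt_one.trans_le h.one_le
  have hn0 : n ≠ 0 := by omega
  have hv := volume_ball_toReal_pos hn
  set v := (volume (Metric.ball (0 : Rn n) 1)).toReal with hvdef
  obtain ⟨D, hD, hdbl⟩ := h.exists_le_mul hv
  set φ : ℝ → ℝ := fun s => Φ (s ^ (1 / (n : ℝ))) with hφ
  have hΦ : ∀ r, 0 < r → Φ r ≤ D * φ (v * r ^ n) := by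
    intro r hr
    have := hdbl (r ^ n) (by positivity)
    rwa [show (r ^ n) ^ (1 / (n : ℝ)) = r by
      rw [one_div]; exact Real.pow_rpow_inv_natCast hr.le hn0] at this
  -- With `M = 2DC²`, a level `M H` covers the large balls, or the bounded part of `f` on small
  -- balls; the part of `f` above `f^*(t)` on small balls costs `5^n M H`.
  refine ⟨(2 * D * C ^ 2 * (1 + 5 ^ n)).toNNReal, by simp only [Real.toNNReal_pos]; positivity,
    fun f hf t ht => ?_⟩
  set H := supAvg φ (rearr volume f) t with hH
  set M := 2 * D * C ^ 2 with hM
  have hM0 : 0 < M := by positivity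
  set I : ℝ → ℝ≥0∞ := fun τ => ∫⁻ s in Ioo 0 τ, rearr volume f s with hI
  have hIt : ENNReal.ofReal (φ t) * I t ≤ ENNReal.ofReal (2 * C) * H := h.mul_lintegral_le_supAvg _ ht
  have hK : ((M * (1 + 5 ^ n)).toNNReal : ℝ≥0∞) = ENNReal.ofReal M + 5 ^ n * ENNReal.ofReal M := by
    change ENNReal.ofReal _ = _
    rw [mul_add, mul_one, ENNReal.ofReal_add (by positivity) (by positivity),
      ENNReal.ofReal_mul hM0.le, ENNReal.ofReal_pow (by norm_num), mul_comm (ENNReal.ofReal M) (_ ^ _)]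
    norm_num
  rw [hK]
  rcases eq_or_ne H ∞ with hHt | hHt
  · rw [hHt, ENNReal.mul_top]
    · exact le_top
    · simp [hM0]
  have hball : ∀ x r, 0 < r → ∫⁻ y in Metric.ball x r, f y ≤ I (v * r ^ n) := fun x r hr =>
    setLIntegral_le_lintegral_rearr hf (volume_ball_eq hn x hr.le).le
  have hlarge : ∀ x r, 0 < r → t ≤ v * r ^ n →
      ENNReal.ofReal (Φ r) * ∫⁻ y in Metric.ball x r, f y ≤ ENNReal.ofReal M * H := by
    intro x r hr htr
    have hpos : 0 < v * r ^ n := by positivity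
    calc _ ≤ ENNReal.ofReal (D * φ (v * r ^ n)) * I (v * r ^ n) := by
          gcongr
          · exact hΦ r hr
          · exact hball x r hr
      _ = ENNReal.ofReal D * (ENNReal.ofReal (φ (v * r ^ n)) * I (v * r ^ n)) := by
          rw [ENNReal.ofReal_mul hD.le, mul_assoc]
      _ ≤ ENNReal.ofReal D * (ENNReal.ofReal (2 * C) * H) := by
          refine mul_le_mul' le_rfl ((h.mul_lintegral_le_supAvg _ hpos).trans ?_)
          exact mul_le_mul' le_rfl (supAvg_antitone _ _ htr)
      _ ≤ _ := by
          rw [← mul_assoc, ← ENNReal.ofReal_mul hD.le]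
          gcongr
          rw [hM]
          nlinarith [mul_le_mul_of_nonneg_left hC1 (mul_pos hD hC).le]
  have hsmall : ∀ r, 0 < r → v * r ^ n < t →
      ENNReal.ofReal (Φ r) * ENNReal.ofReal (v * r ^ n) ≤ ENNReal.ofReal (D * C * (t * φ t)) := by
    intro r hr hrt
    have hpos : 0 < v * r ^ n := by positivity
    rw [← ENNReal.ofReal_mul (hB.pos r hr).le]
    refine ENNReal.ofReal_le_ofReal ?_
    calc Φ r * (v * r ^ n) ≤ D * φ (v * r ^ n) * (v * r ^ n) := by gcongr; exact hΦ r hr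
      _ = D * (v * r ^ n * φ (v * r ^ n)) := by ring
      _ ≤ D * (C * (t * φ t)) := mul_le_mul_of_nonneg_left (h.mul_le hpos hrt.le) hD.le
      _ = _ := by ring
  have hbI : ENNReal.ofReal (D * C * (t * φ t)) * I t ≤ ENNReal.ofReal M * H * ENNReal.ofReal t := by
    calc _ = ENNReal.ofReal (D * C) * ENNReal.ofReal t * (ENNReal.ofReal (φ t) * I t) := by
          rw [ENNReal.ofReal_mul (by positivity), ENNReal.ofReal_mul ht.le]
          ring
      _ ≤ ENNReal.ofReal (D * C) * ENNReal.ofReal t * (ENNReal.ofReal (2 * C) * H) :=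
          mul_le_mul' le_rfl hIt
      _ = _ := by
          rw [hM, show 2 * D * C ^ 2 = D * C * (2 * C) by ring,
            ENNReal.ofReal_mul (p := D * C) (q := 2 * C) (by positivity)]
          ring
  -- Since `|A| ≤ t`, the integral of `f` over `A` is at most `∫_0^t f^*`, and outside `A` the
  -- function is at most `f^*(t)`.
  set A : Set (Rn n) := {x | rearr volume f t < f x} with hA
  have hAn : NullMeasurableSet A volume := nullMeasurableSet_lt aemeasurable_const hf
  set f₁ : Rn n → ℝ≥0∞ := A.indicator f with hf₁
  have hf₁I : ∫⁻ x, f₁ x ≤ I t := by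
    rw [hf₁, lintegral_indicator₀ hAn]
    exact setLIntegral_le_lintegral_rearr hf (rearr_le_iff.1 le_rfl)
  have hsplit : ∀ x, f x ≤ f₁ x + rearr volume f t := by
    intro x
    by_cases hx : x ∈ A
    · rw [hf₁, indicator_of_mem hx]
      exact le_self_add
    · rw [hf₁, indicator_of_notMem hx, zero_add]
      exact not_lt.1 hx
  rw [rearr_le_iff]
  refine le_trans (measure_mono (t := {x | ∃ r, 0 < r ∧ v * r ^ n < t ∧
      5 ^ n * (ENNReal.ofReal M * H) <
        ENNReal.ofReal (Φ r) * ∫⁻ y in Metric.ball x r, f₁ y}) fun x hx => ?_) ?_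
  · obtain ⟨r, hr⟩ := lt_iSup_iff.1 (mem_ofPred_eq.mp hx)
    obtain ⟨hr0, hr⟩ := lt_iSup_iff.1 hr
    have hrt : v * r ^ n < t := by
      by_contra! hle
      refine absurd (hlarge x r hr0 hle) (not_le.2 (lt_of_le_of_lt ?_ hr))
      gcongr
      exact le_self_add
    refine ⟨r, hr0, hrt, ?_⟩
    by_contra! hle
    refine absurd hr (not_lt.2 ?_)
    calc _ ≤ ENNReal.ofReal (Φ r) * ∫⁻ y in Metric.ball x r, (f₁ y + rearr volume f t) := by
          gcongr with y
          exact hsplit y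
      _ = ENNReal.ofReal (Φ r) * ENNReal.ofReal (v * r ^ n) * rearr volume f t +
          ENNReal.ofReal (Φ r) * ∫⁻ y in Metric.ball x r, f₁ y := by
          rw [lintegral_add_right _ measurable_const, setLIntegral_const, volume_ball_eq hn x hr0.le]
          ring
      _ ≤ ENNReal.ofReal M * H + 5 ^ n * (ENNReal.ofReal M * H) := by
          refine add_le_add ?_ hle
          have ht0 : ENNReal.ofReal t ≠ 0 := by simpa using ht
          refine (ENNReal.mul_le_mul_iff_left ht0 ENNReal.ofReal_ne_top).1 (le_trans ?_ hbI)
          rw [mul_assoc, mul_comm (rearr volume f t)]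
          exact mul_le_mul' (hsmall r hr0 hrt) (ofReal_mul_rearr_le f t)
      _ = _ := by ring
  -- The covering estimate requires a non-zero level. If `H = 0`, then `f₁` has zero integral and
  -- the exceptional set is empty.
  · rcases eq_or_ne H 0 with hH0 | hH0
    · have hI0 : I t = 0 := by
        rw [hH0, mul_zero, nonpos_iff_eq_zero, mul_eq_zero] at hIt
        refine hIt.resolve_left ?_
        simpa using h.pos t ht
      have hf0 : ∀ x r, ∫⁻ y in Metric.ball x r, f₁ y = 0 := fun x r =>
        le_antisymm ((setLIntegral_le_lintegral _ _).trans (hf₁I.trans hI0.le)) bot_le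
      simp [hf0, hH0]
    · refine volume_small_balls_le hn ?_ ?_ hsmall (le_trans (mul_le_mul' le_rfl hf₁I) hbI)
      · exact mul_ne_zero (by simpa using hM0) hH0
      · exact ENNReal.mul_ne_top ENNReal.ofReal_ne_top hHt

/-! ### Function norms -/

section FunctionNorm

variable {α : Type*} [MeasurableSpace α] {μ : Measure α} {ρ : (α → ℝ≥0∞) → ℝ≥0∞}

theorem IsFunctionNorm.congr_ae (hρ : IsFunctionNorm μ ρ) {f g : α → ℝ≥0∞} (hf : AEMeasurable f μ)
    (h : f =ᵐ[μ] g) : ρ f = ρ g :=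
  have hg := hf.congr h
  le_antisymm (hρ.mono f g hf hg h.le) (hρ.mono g f hg hf h.symm.le)

/-- A finite norm bounds the integral over each set of finite positive measure, and countably many
sets of finite measure exhaust the space. -/
theorem IsFunctionNorm.ae_lt_top [SigmaFinite μ] (hρ : IsFunctionNorm μ ρ) {f : α → ℝ≥0∞}
    (hf : AEMeasurable f μ) (h : ρ f < ∞) : ∀ᵐ x ∂μ, f x < ∞ := by
  rw [← Measure.restrict_univ (μ := μ), ← iUnion_spanningSets μ, ae_restrict_iUnion_iff]
  intro k
  rcases eq_zero_or_pos (μ (spanningSets μ k)) with h0 | h0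
  · rw [Measure.restrict_eq_zero.2 h0]
    exact ae_zero.symm ▸ eventually_bot
  · obtain ⟨c, hc⟩ := hρ.lintegral_le _ (measurableSet_spanningSets μ k) h0
      (measure_spanningSets_lt_top μ k)
    exact ae_lt_top' hf.restrict
      ((hc f hf).trans_lt (ENNReal.mul_lt_top ENNReal.coe_lt_top h)).ne

theorem IsFunctionNorm.sum_range_le (hρ : IsFunctionNorm μ ρ) {g : ℕ → α → ℝ≥0∞}
    (hg : ∀ k, AEMeasurable (g k) μ) (N : ℕ) :
    ρ (fun x => ∑ k ∈ Finset.range N, g k x) ≤ ∑ k ∈ Finset.range N, ρ (g k) := by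
  induction N with
  | zero =>
    simp only [Finset.range_zero, Finset.sum_empty, nonpos_iff_eq_zero]
    exact (hρ.eq_zero_iff _ aemeasurable_const).2 (Eventually.of_forall fun _ => rfl)
  | succ N ih =>
    simp only [Finset.sum_range_succ]
    exact (hρ.add_le _ _ (Finset.aemeasurable_fun_sum _ fun k _ => hg k) (hg N)).trans
      (add_le_add ih le_rfl)

/-- The Riesz–Fischer property. -/
theorem IsFunctionNorm.tsum_le (hρ : IsFunctionNorm μ ρ) {g : ℕ → α → ℝ≥0∞}
    (hg : ∀ k, AEMeasurable (g k) μ) : ρ (fun x => ∑' k, g k x) ≤ ∑' k, ρ (g k) := by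
  have h := hρ.fatou (fun N x => ∑ k ∈ Finset.range N, g k x) (fun x => ∑' k, g k x)
    (fun N => Finset.aemeasurable_fun_sum _ fun k _ => hg k) (AEMeasurable.tsum hg)
    (fun N => Eventually.of_forall fun x => by
      simp only [Finset.sum_range_succ]
      exact le_self_add)
    (Eventually.of_forall fun x => ENNReal.tendsto_nat_tsum _)
  exact le_of_tendsto' h fun N => (hρ.sum_range_le hg N).trans (ENNReal.sum_le_tsum _)

theorem IsFunctionNorm.le_mul_of_ae_le (hρ : IsFunctionNorm μ ρ) {h k : α → ℝ≥0∞} {K : ℝ≥0}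
    (hh : AEMeasurable h μ) (hk : AEMeasurable k μ) (hle : ∀ᵐ t ∂μ, h t ≤ K * k t) :
    ρ h ≤ K * ρ k := by
  rw [← hρ.smul K k hk]
  exact hρ.mono _ _ hh (hk.const_mul _) hle

/-- A function with finite norm is, up to a null set, the modulus of a function in the space. -/
theorem IsFunctionNorm.exists_mem_space [SigmaFinite μ] (hρ : IsFunctionNorm μ ρ) {g : α → ℝ≥0∞}
    (hg : AEMeasurable g μ) (h : ρ g < ∞) :
    ∃ f ∈ space μ ρ, (fun x => ‖f x‖ₑ) =ᵐ[μ] g ∧ ρ (fun x => ‖f x‖ₑ) = ρ g := by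
  have he : (fun x => ‖((g x).toReal : ℂ)‖ₑ) =ᵐ[μ] g := by
    filter_upwards [hρ.ae_lt_top hg h] with x hx
    rw [← enorm_norm, Complex.norm_real, enorm_norm, Real.enorm_of_nonneg ENNReal.toReal_nonneg,
      ENNReal.ofReal_toReal hx.ne]
  have hn : ρ (fun x => ‖((g x).toReal : ℂ)‖ₑ) = ρ g := (hρ.congr_ae hg he.symm).symm
  exact ⟨fun x => ((g x).toReal : ℂ),
    ⟨Complex.measurable_ofReal.comp_aemeasurable hg.ennreal_toReal, hn ▸ h⟩, he, hn⟩

end FunctionNorm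

/-! ### From inclusion to boundedness -/

theorem ae_volPos {p : ℝ → Prop} (h : ∀ t, 0 < t → p t) : ∀ᵐ t ∂volPos, p t :=
  (ae_restrict_iff' measurableSet_Ioi).2 (Eventually.of_forall h)

/-- The inclusion of the maximal space is equivalent to its boundedness. -/
theorem MaxSubset.exists_bound {n : ℕ} {Φ : ℝ → ℝ} {ρE ρX : (Rn n → ℝ≥0∞) → ℝ≥0∞}
    (hE : IsFunctionNorm volume ρE) (hX : IsFunctionNorm volume ρX) (h : MaxSubset n Φ ρE ρX) :
    ∃ C : ℝ≥0, 0 < C ∧ ∀ f ∈ space volume ρE,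
      ρX (maximal n Φ f) ≤ C * ρE (fun x => ‖f x‖ₑ) := by
  by_contra! hcon
  -- Scaling `f_k` to norm `2^{-k}` makes the sum of the moduli a function `F` of `E`. Since `M_Φ F`
  -- dominates each scaled `M_Φ f_k`, its norm in `X` is at least `4^k 2^{-k} = 2^k` for every `k`.
  choose f hfE hf using fun k : ℕ => hcon (4 ^ k) (by positivity)
  have hm : ∀ k, AEMeasurable (fun x => ‖f k x‖ₑ) volume := fun k => (hfE k).1.enorm
  have hne : ∀ k, ρE (fun x => ‖f k x‖ₑ) ≠ 0 := by
    intro k h0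
    have h1 : (fun x => ‖f k x‖ₑ) =ᵐ[volume] 0 := (hE.eq_zero_iff _ (hm k)).1 h0
    have h2 : maximal n Φ (f k) = 0 := by
      rw [maximal_eq_maxFn, maxFn_congr_ae Φ h1]
      funext x
      simp [maxFn]
    have h3 := hf k
    rw [h0, h2, (hX.eq_zero_iff 0 aemeasurable_const).2 (ae_eq_refl _)] at h3
    simp at h3
  have hfin : ∀ k, ρE (fun x => ‖f k x‖ₑ) ≠ ∞ := fun k => (hfE k).2.ne
  let a : ℕ → ℝ≥0 := fun k => (2⁻¹) ^ k * (ρE (fun x => ‖f k x‖ₑ)).toNNReal⁻¹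
  have ha : ∀ k, (a k : ℝ≥0∞) * ρE (fun x => ‖f k x‖ₑ) = 2⁻¹ ^ k := by
    intro k
    have hN : (ρE (fun x => ‖f k x‖ₑ)).toNNReal ≠ 0 := by
      simp [ENNReal.toNNReal_eq_zero_iff, hne k, hfin k]
    rw [← ENNReal.coe_toNNReal (hfin k), ← ENNReal.coe_mul]
    simp only [a, mul_assoc]
    rw [inv_mul_cancel₀ hN, mul_one]
    push_cast
    rfl
  let g : ℕ → Rn n → ℝ≥0∞ := fun k x => a k * ‖f k x‖ₑ
  have hgm : ∀ k, AEMeasurable (g k) volume := fun k => (hm k).const_mul _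
  have hgE : ∀ k, ρE (g k) = 2⁻¹ ^ k := fun k => (hE.smul _ _ (hm k)).trans (ha k)
  have hsum : ρE (fun x => ∑' k, g k x) < ∞ := by
    refine (hE.tsum_le hgm).trans_lt ?_
    simp only [hgE, ENNReal.tsum_geometric]
    norm_num
  obtain ⟨F, hF, hFg, -⟩ := hE.exists_mem_space (AEMeasurable.tsum hgm) hsum
  have hlt : ρX (maximal n Φ F) < ∞ := (h _ ⟨F, hF, rfl⟩).2
  have hge : ∀ k : ℕ, (2 : ℝ≥0∞) ^ k ≤ ρX (maximal n Φ F) := by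
    intro k
    calc (2 : ℝ≥0∞) ^ k = (a k : ℝ≥0∞) * (((4 ^ k : ℝ≥0) : ℝ≥0∞) * ρE (fun x => ‖f k x‖ₑ)) := by
          rw [mul_left_comm, ha k]
          push_cast
          rw [← mul_pow]
          congr 1
          rw [show (4 : ℝ≥0∞) = 2 * 2 by norm_num, mul_assoc,
            ENNReal.mul_inv_cancel (by norm_num) (by norm_num), mul_one]
      _ ≤ (a k : ℝ≥0∞) * ρX (maximal n Φ (f k)) := mul_le_mul' le_rfl (hf k).le
      _ = ρX (fun x => a k * maximal n Φ (f k) x) :=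
          (hX.smul _ _ (measurable_maxFn Φ _).aemeasurable).symm
      _ ≤ _ := by
          refine hX.mono _ _ ((measurable_maxFn Φ _).const_mul _).aemeasurable
            (measurable_maxFn Φ _).aemeasurable (Eventually.of_forall fun x => ?_)
          simp only [maximal_eq_maxFn]
          rw [← maxFn_const_mul Φ _ ENNReal.coe_ne_top]
          refine maxFn_mono Φ ?_ x
          filter_upwards [hFg] with y hy
          rw [hy]
          exact ENNReal.le_tsum (f := fun k => g k y) k
  have htop : Tendsto (fun k : ℕ => (2 : ℝ≥0∞) ^ k) atTop (𝓝 ∞) :=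
    ENNReal.tendsto_pow_atTop_nhds_top_iff.2 (by norm_num)
  exact absurd (le_of_tendsto' htop hge) (not_le.2 hlt)

/-! ### Embeddings of image cones -/

theorem le_mul_iInf₂ {ι : Sort*} {p : ι → Prop} {N : ι → ℝ≥0∞} {x : ℝ≥0∞} {C : ℝ≥0} (hC : 0 < C)
    (h : ∀ i, p i → x ≤ C * N i) : x ≤ C * ⨅ (i) (_ : p i), N i := by
  -- Positivity matters when no index satisfies `p`: the infimum is then `∞`, whereas `0 * ∞ = 0`.
  have hC0 : (C : ℝ≥0∞) ≠ 0 := by simpa using hC.ne'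
  rw [mul_comm, ← ENNReal.div_le_iff_le_mul (.inl hC0) (.inl ENNReal.coe_ne_top)]
  refine le_iInf₂ fun i hi => ?_
  rw [ENNReal.div_le_iff_le_mul (.inl hC0) (.inl ENNReal.coe_ne_top), mul_comm]
  exact h i hi

/-- A bound for the operator `T` suffices: the norm sees functions only up to null sets of `(0,∞)`,
so any representative agreeing with `T u` there has the same norm. -/
theorem imageCone_embeds {U : Type*} {S : Set U} {N : U → ℝ≥0∞} {T : U → ℝ → ℝ≥0∞}
    {ρ : (ℝ → ℝ≥0∞) → ℝ≥0∞} (hρ : IsFunctionNorm volPos ρ) {C : ℝ≥0} (hC : 0 < C)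
    (hN : ∀ u ∈ S, N u < ∞) (h : ∀ u ∈ S, ρ (T u) ≤ C * N u) : (imageCone S N T).Embeds ρ := by
  have key : ∀ g, AEMeasurable g volPos → ∀ u ∈ S, (∀ t, 0 < t → g t = T u t) → ρ g ≤ C * N u := by
    intro g hg u hu hgu
    rw [hρ.congr_ae hg (ae_volPos hgu)]
    exact h u hu
  refine ⟨?_, C, hC, ?_⟩
  · rintro g ⟨hg, u, hu, hgu⟩
    exact ⟨hg, (key g hg u hu hgu).trans_lt (ENNReal.mul_lt_top ENNReal.coe_lt_top (hN u hu))⟩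
  · rintro g ⟨hg, -⟩
    exact le_mul_iInf₂ hC fun u hu => key g hg u hu.1 hu.2

theorem maxNorm_lt_top {n : ℕ} {Φ : ℝ → ℝ} {ρE : (Rn n → ℝ≥0∞) → ℝ≥0∞} {u : Rn n → ℝ≥0∞}
    (hu : u ∈ maxSpace n Φ ρE) : maxNorm n Φ ρE u < ∞ := by
  obtain ⟨f, hf, hfu⟩ := hu
  exact (iInf₂_le f ⟨hf, hfu⟩).trans_lt hf.2

theorem aemeasurable_of_mem_maxSpace {n : ℕ} {Φ : ℝ → ℝ} {ρE : (Rn n → ℝ≥0∞) → ℝ≥0∞}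
    {u : Rn n → ℝ≥0∞} (hu : u ∈ maxSpace n Φ ρE) : AEMeasurable u volume := by
  obtain ⟨f, -, rfl⟩ := hu
  exact (measurable_maxFn Φ _).aemeasurable

theorem measurable_rearrAvg {α : Type*} [MeasurableSpace α] (μ : Measure α) (f : α → ℝ≥0∞) :
    Measurable (rearrAvg μ f) := by
  have : Monotone fun t : ℝ => ∫⁻ τ in Ioo 0 t, rearr μ f τ := fun _ _ hst =>
    lintegral_mono_set (Ioo_subset_Ioo_right hst)
  exact (ENNReal.measurable_ofReal.inv).mul this.measurable

theorem iSup_rearrAvg_eq_supAvg {α : Type*} [MeasurableSpace α] (μ : Measure α) (f : α → ℝ≥0∞)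
    (φ : ℝ → ℝ) {t : ℝ} (ht : 0 < t) :
    ⨆ (τ : ℝ) (_ : t < τ), ENNReal.ofReal (τ * φ τ) * rearrAvg μ f τ =
      supAvg φ (rearr μ f) t :=
  iSup_congr fun _ => iSup_congr fun hτ => ofReal_mul_rearrAvg f (ht.trans hτ)

/-- The pointwise bound for `(M_Φ f)^*` is averaged over `(0,t)`, and `IsWeight.lintegral_supAvg_le`
absorbs the average. -/
theorem exists_rearrAvg_maxFn_le_supAvg {n : ℕ} (hn : 1 ≤ n) {Φ : ℝ → ℝ} (hB : ClassB n Φ) :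
    ∃ K : ℝ≥0, 0 < K ∧ ∀ (f : Rn n → ℝ≥0∞), AEMeasurable f volume → ∀ t, 0 < t →
      rearrAvg volume (maxFn n Φ f) t ≤
        K * supAvg (fun s => Φ (s ^ (1 / (n : ℝ)))) (rearr volume f) t := by
  obtain ⟨C, h⟩ := hB.isWeight hn
  obtain ⟨K, hK, hle⟩ := exists_rearr_maxFn_le_supAvg hn hB
  have hC : 0 < 1 + 2 * C ^ 2 := by positivity
  refine ⟨K * (1 + 2 * C ^ 2).toNNReal, mul_pos hK (by simpa using hC), fun f hf t ht => ?_⟩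
  have ht0 : ENNReal.ofReal t ≠ 0 := by simpa using ht
  set G := supAvg (fun s => Φ (s ^ (1 / (n : ℝ)))) (rearr volume f) with hG
  calc rearrAvg volume (maxFn n Φ f) t
      ≤ (ENNReal.ofReal t)⁻¹ * ∫⁻ s in Ioo 0 t, K * G s :=
        mul_le_mul' le_rfl (setLIntegral_mono' measurableSet_Ioo fun s hs => hle f hf s hs.1)
    _ ≤ (ENNReal.ofReal t)⁻¹ *
        (K * (ENNReal.ofReal (1 + 2 * C ^ 2) * (ENNReal.ofReal t * G t))) := by
        rw [lintegral_const_mul' _ _ ENNReal.coe_ne_top]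
        exact mul_le_mul' le_rfl (mul_le_mul' le_rfl (h.lintegral_supAvg_le _ ht))
    _ = ((ENNReal.ofReal t)⁻¹ * ENNReal.ofReal t) *
        (K * ENNReal.ofReal (1 + 2 * C ^ 2) * G t) := by ring
    _ = _ := by
        rw [ENNReal.inv_mul_cancel ht0 ENNReal.ofReal_ne_top, one_mul, ENNReal.coe_mul]
        rfl

/-! ### The operator of the fourth cone -/

/-- `φ(t) ∫_0^t f^* + sup_{τ > t} τ φ(τ) f^*(τ)`. -/
noncomputable def avgAddSup {α : Type*} [MeasurableSpace α] (μ : Measure α) (φ : ℝ → ℝ)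
    (f : α → ℝ≥0∞) (t : ℝ) : ℝ≥0∞ :=
  ENNReal.ofReal (t * φ t) * rearrAvg μ f t +
    ⨆ (τ : ℝ) (_ : t < τ), ENNReal.ofReal (τ * φ τ) * rearr μ f τ

section

variable {α : Type*} [MeasurableSpace α] (μ : Measure α) {φ : ℝ → ℝ} {C : ℝ}

theorem IsWeight.avgAddSup_le (h : IsWeight φ C) (f : α → ℝ≥0∞) {t : ℝ} (ht : 0 < t) :
    avgAddSup μ φ f t ≤ ((2 * C + 1).toNNReal : ℝ≥0) * supAvg φ (rearr μ f) t := by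
  have hC := zero_lt_one.trans_le h.one_le
  change _ ≤ ENNReal.ofReal (2 * C + 1) * _
  rw [avgAddSup, ofReal_mul_rearrAvg f ht, ENNReal.ofReal_add (by positivity) zero_le_one,
    ENNReal.ofReal_one, add_mul, one_mul]
  refine add_le_add (h.mul_lintegral_le_supAvg _ ht) (iSup₂_le fun τ hτ => ?_)
  refine le_trans ?_ (le_supAvg φ _ hτ)
  rw [← ofReal_mul_rearrAvg f (ht.trans hτ)]
  exact mul_le_mul' le_rfl (rearr_le_rearrAvg f (ht.trans hτ))

/-- Split `∫_0^τ f^*` at `t`. With `S` the supremum in `avgAddSup`, `f^*(s) ≤ S / (s φ(s))` for `s >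
t`, and the hypothesis bounds the integral of `1 / (s φ(s))` by `D / φ(τ)`, which cancels the
prefactor `φ(τ)`. On `(0,t)` one uses `φ(τ) ≤ φ(t)`. -/
theorem IsWeight.supAvg_le_avgAddSup (h : IsWeight φ C) {D : ℝ} (hD : 0 < D)
    (hφ : ∀ τ, 0 < τ →
      ∫⁻ s in Ioo 0 τ, ENNReal.ofReal (1 / (φ s * s)) ≤ ENNReal.ofReal (D / φ τ))
    (f : α → ℝ≥0∞) {t : ℝ} (ht : 0 < t) :
    supAvg φ (rearr μ f) t ≤ ((1 + D).toNNReal : ℝ≥0) * avgAddSup μ φ f t := by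
  change _ ≤ ENNReal.ofReal (1 + D) * _
  have hcoef : 1 ≤ ENNReal.ofReal (1 + D) := by
    rw [← ENNReal.ofReal_one]
    exact ENNReal.ofReal_le_ofReal (by linarith)
  set S : ℝ≥0∞ := ⨆ (τ : ℝ) (_ : t < τ), ENNReal.ofReal (τ * φ τ) * rearr μ f τ with hS
  -- Finiteness of `S` is used below to take it out of the integral; for `S = ∞` the right side is
  -- infinite.
  rcases eq_or_ne S ∞ with hST | hST
  · rw [avgAddSup, ← hS, hST, add_top, ENNReal.mul_top]
    · exact le_top
    · exact (zero_lt_one.trans_le hcoef).ne'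
  refine iSup₂_le fun τ hτ => ?_
  have hτ0 := ht.trans hτ
  have hsub : ∫⁻ s in Ioo 0 τ, rearr μ f s ≤
      (∫⁻ s in Ioo 0 t, rearr μ f s) + ENNReal.ofReal (D / φ τ) * S := by
    calc ∫⁻ s in Ioo 0 τ, rearr μ f s
        ≤ ∫⁻ s in Ioo 0 t ∪ {t} ∪ Ioo t τ, rearr μ f s := by
          refine lintegral_mono_set fun s hs => ?_
          rcases lt_trichotomy s t with h1 | h1 | h1
          · exact .inl (.inl ⟨hs.1, h1⟩)
          · exact .inl (.inr h1)
          · exact .inr ⟨h1, hs.2⟩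
      _ ≤ (∫⁻ s in Ioo 0 t, rearr μ f s) + 0 + ∫⁻ s in Ioo t τ, rearr μ f s := by
          refine (lintegral_union_le _ _ _).trans (add_le_add ?_ le_rfl)
          refine (lintegral_union_le _ _ _).trans (add_le_add le_rfl ?_)
          exact (setLIntegral_measure_zero _ _ Real.volume_singleton).le
      _ ≤ _ := by
          rw [add_zero]
          refine add_le_add le_rfl ?_
          calc ∫⁻ s in Ioo t τ, rearr μ f s
              ≤ ∫⁻ s in Ioo t τ, ENNReal.ofReal (1 / (φ s * s)) * S := by
                refine setLIntegral_mono' measurableSet_Ioo fun s hs => ?_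
                have hs0 := ht.trans hs.1
                have hφs := h.pos s hs0
                have hle : ENNReal.ofReal (s * φ s) * rearr μ f s ≤ S :=
                  le_iSup₂ (f := fun (τ : ℝ) (_ : t < τ) =>
                    ENNReal.ofReal (τ * φ τ) * rearr μ f τ) s hs.1
                calc rearr μ f s = ENNReal.ofReal (1 / (φ s * s)) *
                      (ENNReal.ofReal (s * φ s) * rearr μ f s) := by
                      rw [← mul_assoc, ← ENNReal.ofReal_mul (by positivity),
                        show 1 / (φ s * s) * (s * φ s) = 1 by field_simp, ENNReal.ofReal_one, one_mul]
                  _ ≤ _ := mul_le_mul' le_rfl hle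
            _ ≤ ∫⁻ s in Ioo 0 τ, ENNReal.ofReal (1 / (φ s * s)) * S :=
                lintegral_mono_set (Ioo_subset_Ioo_left ht.le)
            _ ≤ _ := by
                rw [lintegral_mul_const' _ _ hST]
                exact mul_le_mul' (hφ τ hτ0) le_rfl
  have hφτ := h.pos τ hτ0
  calc ENNReal.ofReal (φ τ) * ∫⁻ s in Ioo 0 τ, rearr μ f s
      ≤ ENNReal.ofReal (φ τ) *
        ((∫⁻ s in Ioo 0 t, rearr μ f s) + ENNReal.ofReal (D / φ τ) * S) := mul_le_mul' le_rfl hsub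
    _ = ENNReal.ofReal (φ τ) * (∫⁻ s in Ioo 0 t, rearr μ f s) + ENNReal.ofReal D * S := by
        rw [mul_add, ← mul_assoc, ← ENNReal.ofReal_mul hφτ.le,
          show φ τ * (D / φ τ) = D by field_simp]
    _ ≤ ENNReal.ofReal (1 + D) * (ENNReal.ofReal (φ t) * ∫⁻ s in Ioo 0 t, rearr μ f s) +
        ENNReal.ofReal (1 + D) * S := by
        refine add_le_add ?_ (mul_le_mul' (ENNReal.ofReal_le_ofReal (by linarith)) le_rfl)
        refine le_trans ?_ (le_mul_of_one_le_left bot_le hcoef)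
        exact mul_le_mul' (ENNReal.ofReal_le_ofReal (h.anti _ _ ht hτ.le)) le_rfl
    _ = _ := by rw [avgAddSup, ofReal_mul_rearrAvg f ht, ← hS, mul_add]

theorem IsWeight.aemeasurable_avgAddSup (h : IsWeight φ C) (f : α → ℝ≥0∞) :
    AEMeasurable (avgAddSup μ φ f) volPos := by
  have h1 : AEMeasurable φ volPos :=
    aemeasurable_restrict_of_antitoneOn measurableSet_Ioi fun a ha b _ hab => h.anti _ _ ha hab
  have h2 : Antitone fun t : ℝ => ⨆ (τ : ℝ) (_ : t < τ), ENNReal.ofReal (τ * φ τ) * rearr μ f τ :=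
    fun s t hst => biSup_mono fun _ hτ => hst.trans_lt hτ
  exact ((ENNReal.measurable_ofReal.comp_aemeasurable (aemeasurable_id.mul h1)).mul
    (measurable_rearrAvg μ f).aemeasurable).add h2.measurable.aemeasurable

end

theorem ClassD.lintegral_rpow_le {n : ℕ} (hn : 1 ≤ n) {Φ : ℝ → ℝ} (h : ClassD n Φ) :
    ∃ D : ℝ, 0 < D ∧ ∀ τ, 0 < τ →
      ∫⁻ s in Ioo 0 τ, ENNReal.ofReal (1 / (Φ (s ^ (1 / (n : ℝ))) * s)) ≤
        ENNReal.ofReal (D / Φ (τ ^ (1 / (n : ℝ)))) := by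
  obtain ⟨D, hD, hle⟩ := h.lintegral_le
  refine ⟨D, hD, fun τ hτ => ?_⟩
  have := hle (τ ^ (1 / (n : ℝ))) (by positivity)
  rwa [show (τ ^ (1 / (n : ℝ))) ^ n = τ by
    rw [one_div]; exact Real.rpow_inv_natCast_pow hτ.le (by omega)] at this

/-! ### The equivalences for the four cones -/

section Embedding

variable {n : ℕ} {Φ : ℝ → ℝ} {ρE ρX : (Rn n → ℝ≥0∞) → ℝ≥0∞}

/-- Serves the direction from a cone to the inclusion in all four cases. Only membership of the
majorant is needed, so `K` may depend on `f`. -/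
theorem maxSubset_of_rearr_le (hn : 1 ≤ n) (hX : IsRINorm volume ρX)
    (h : ∀ f ∈ space volume ρE, ∃ k, MemSpace volPos (luxemburg n ρX) k ∧
      ∃ K : ℝ≥0, ∀ t, 0 < t → rearr volume (maximal n Φ f) t ≤ K * k t) :
    MaxSubset n Φ ρE ρX := by
  rintro _ ⟨f, hf, rfl⟩
  have hm : AEMeasurable (maximal n Φ f) volume := (measurable_maxFn Φ _).aemeasurable
  obtain ⟨k, ⟨hk, hkX⟩, K, hle⟩ := h f hf
  refine ⟨hm, ?_⟩
  rw [← luxemburg_rearr hn hX hm]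
  refine ((luxemburg_isRINorm hn hX).le_mul_of_ae_le
    (rearr_antitone _ _).measurable.aemeasurable hk (ae_volPos hle)).trans_lt ?_
  exact ENNReal.mul_lt_top ENNReal.coe_lt_top hkX

/-- Serves the direction from the inclusion to the second, third and fourth cones. The norm bound is
applied to the radial rearrangement of `f`, for which the lower estimate of the maximal function
holds and whose norm in `E` is unchanged. -/
theorem MaxSubset.exists_luxemburg_supAvg_le (hn : 1 ≤ n) (hB : ClassB n Φ)
    (hE : IsRINorm volume ρE) (hX : IsRINorm volume ρX) (h : MaxSubset n Φ ρE ρX) :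
    ∃ C : ℝ≥0, 0 < C ∧ ∀ f ∈ space volume ρE,
      luxemburg n ρX (supAvg (fun s => Φ (s ^ (1 / (n : ℝ)))) (rearr volume fun x => ‖f x‖ₑ)) ≤
        C * ρE (fun x => ‖f x‖ₑ) := by
  obtain ⟨C, hC, hbd⟩ := h.exists_bound hE.toIsFunctionNorm hX.toIsFunctionNorm
  obtain ⟨K, hK, hle⟩ := exists_supAvg_le_rearr_maxFn hn hB
  refine ⟨K * C, mul_pos hK hC, fun f hf => ?_⟩
  set g := rearr volume fun x => ‖f x‖ₑ with hg
  have hgm : Measurable g := (rearr_antitone _ _).measurable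
  have hgE : ρE (fun x => g (radial n x)) = ρE (fun x => ‖f x‖ₑ) :=
    luxemburg_rearr hn hE hf.1.enorm
  -- The radial rearrangement can be infinite on a null set, so a complex function with the same
  -- modulus almost everywhere takes its place; maximal functions do not notice the change.
  obtain ⟨F, hF, hFg, hFE⟩ := hE.exists_mem_space
    (hgm.comp (radial_measurePreserving n hn).measurable).aemeasurable (hgE ▸ hf.2)
  have hmax : maximal n Φ F = maxFn n Φ fun x => g (radial n x) := by
    rw [maximal_eq_maxFn]
    exact maxFn_congr_ae Φ hFg
  have hm : AEMeasurable (maximal n Φ F) volume := (measurable_maxFn Φ _).aemeasurable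
  calc _ ≤ K * luxemburg n ρX (rearr volume (maximal n Φ F)) := by
        refine (luxemburg_isRINorm hn hX).le_mul_of_ae_le (supAvg_antitone _ _).measurable.aemeasurable
          (rearr_antitone _ _).measurable.aemeasurable (ae_volPos fun t ht => ?_)
        rw [hmax]
        exact hle g hgm t ht
    _ = K * ρX (maximal n Φ F) := by rw [luxemburg_rearr hn hX hm]
    _ ≤ K * (C * ρE (fun x => ‖F x‖ₑ)) := mul_le_mul' le_rfl (hbd F hF)
    _ = _ := by
        rw [ENNReal.coe_mul, mul_assoc, ← hgE]
        exact congrArg (fun z => (K : ℝ≥0∞) * (C * z)) hFE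

theorem maxSubset_iff_maxEmbeds (hE : IsRINorm volume ρE) (hX : IsRINorm volume ρX) :
    MaxSubset n Φ ρE ρX ↔ MaxEmbeds n Φ ρE ρX := by
  refine ⟨fun h => ⟨h, ?_⟩, fun h => h.1⟩
  obtain ⟨C, hC, hbd⟩ := h.exists_bound hE.toIsFunctionNorm hX.toIsFunctionNorm
  refine ⟨C, hC, fun u _ => le_mul_iInf₂ hC ?_⟩
  rintro f ⟨hf, rfl⟩
  exact hbd f hf

theorem maxSubset_iff_cone₁_embeds (hn : 1 ≤ n) (hE : IsRINorm volume ρE)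
    (hX : IsRINorm volume ρX) :
    MaxSubset n Φ ρE ρX ↔ (cone₁ n Φ ρE).Embeds (luxemburg n ρX) := by
  constructor
  · intro h
    obtain ⟨-, C, hC, hbd⟩ := (maxSubset_iff_maxEmbeds hE hX).1 h
    refine imageCone_embeds (luxemburg_isRINorm hn hX).toIsFunctionNorm hC
      (fun u hu => maxNorm_lt_top hu) fun u hu => ?_
    rw [luxemburg_rearr hn hX (aemeasurable_of_mem_maxSpace hu)]
    exact hbd u hu
  · intro h
    refine maxSubset_of_rearr_le hn hX fun f hf => ⟨rearr volume (maximal n Φ f), h.1 _ ?_, 1, ?_⟩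
    · exact ⟨(rearr_antitone _ _).measurable.aemeasurable, _, ⟨f, hf, rfl⟩, fun _ _ => rfl⟩
    · simp

theorem maxSubset_iff_cone₂_embeds (hn : 1 ≤ n) (hB : ClassB n Φ) (hE : IsRINorm volume ρE)
    (hX : IsRINorm volume ρX) :
    MaxSubset n Φ ρE ρX ↔ (cone₂ n Φ ρE).Embeds (luxemburg n ρX) := by
  constructor
  · intro h
    obtain ⟨C, hC, hbd⟩ := h.exists_luxemburg_supAvg_le hn hB hE hX
    obtain ⟨K, hK, hle⟩ := exists_rearrAvg_maxFn_le_supAvg hn hB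
    have hKC : 0 < K * C := mul_pos hK hC
    refine imageCone_embeds (luxemburg_isRINorm hn hX).toIsFunctionNorm hKC
      (fun u hu => maxNorm_lt_top hu) fun u _ => le_mul_iInf₂ hKC ?_
    rintro f ⟨hf, rfl⟩
    refine ((luxemburg_isRINorm hn hX).le_mul_of_ae_le (measurable_rearrAvg _ _).aemeasurable
      (supAvg_antitone _ _).measurable.aemeasurable
      (ae_volPos fun t ht => hle _ hf.1.enorm t ht)).trans ?_
    rw [ENNReal.coe_mul, mul_assoc]
    exact mul_le_mul' le_rfl (hbd f hf)
  · intro h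
    refine maxSubset_of_rearr_le hn hX fun f hf =>
      ⟨rearrAvg volume (maximal n Φ f), h.1 _ ?_, 1, fun t ht => ?_⟩
    · exact ⟨(measurable_rearrAvg _ _).aemeasurable, _, ⟨f, hf, rfl⟩, fun _ _ => rfl⟩
    · simpa using rearr_le_rearrAvg _ ht

theorem maxSubset_iff_cone₃_embeds (hn : 1 ≤ n) (hB : ClassB n Φ) (hE : IsRINorm volume ρE)
    (hX : IsRINorm volume ρX) :
    MaxSubset n Φ ρE ρX ↔ (cone₃ n Φ ρE).Embeds (luxemburg n ρX) := by
  have hT := fun (f : Rn n → ℂ) (t : ℝ) (ht : 0 < t) =>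
    iSup_rearrAvg_eq_supAvg volume (fun x => ‖f x‖ₑ) (fun s => Φ (s ^ (1 / (n : ℝ)))) ht
  constructor
  · intro h
    obtain ⟨C, hC, hbd⟩ := h.exists_luxemburg_supAvg_le hn hB hE hX
    refine imageCone_embeds (luxemburg_isRINorm hn hX).toIsFunctionNorm hC (fun u hu => hu.2)
      fun u hu => ?_
    rw [← (luxemburg_isRINorm hn hX).congr_ae (supAvg_antitone _ _).measurable.aemeasurable
      (ae_volPos fun t ht => (hT u t ht).symm)]
    exact hbd u hu
  · intro h
    obtain ⟨K, -, hle⟩ := exists_rearr_maxFn_le_supAvg hn hB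
    refine maxSubset_of_rearr_le hn hX fun f hf => 
      ⟨supAvg (fun s => Φ (s ^ (1 / (n : ℝ)))) (rearr volume fun x => ‖f x‖ₑ), h.1 _ ?_, K,
        fun t ht => ?_⟩
    · exact ⟨(supAvg_antitone _ _).measurable.aemeasurable, f, hf, fun t ht => (hT f t ht).symm⟩
    · exact hle _ hf.1.enorm t ht

theorem maxSubset_iff_cone₄_embeds (hn : 1 ≤ n) (hB : ClassB n Φ) (hD : ClassD n Φ)
    (hE : IsRINorm volume ρE) (hX : IsRINorm volume ρX) :
    MaxSubset n Φ ρE ρX ↔ (cone₄ n Φ ρE).Embeds (luxemburg n ρX) := by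
  obtain ⟨W, hW⟩ := hB.isWeight hn
  have hW0 := zero_lt_one.trans_le hW.one_le
  constructor
  · intro h
    obtain ⟨C, hC, hbd⟩ := h.exists_luxemburg_supAvg_le hn hB hE hX
    have hKC : 0 < (2 * W + 1).toNNReal * C := mul_pos (by simp only [Real.toNNReal_pos]; positivity) hC
    refine imageCone_embeds (luxemburg_isRINorm hn hX).toIsFunctionNorm hKC (fun u hu => hu.2)
      fun u hu => ?_
    refine ((luxemburg_isRINorm hn hX).le_mul_of_ae_le
      (hW.aemeasurable_avgAddSup volume fun x => ‖u x‖ₑ) (supAvg_antitone _ _).measurable.aemeasurable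
      (ae_volPos fun t ht => hW.avgAddSup_le volume _ ht)).trans ?_
    rw [ENNReal.coe_mul, mul_assoc]
    exact mul_le_mul' le_rfl (hbd u hu)
  · intro h
    obtain ⟨K, -, hle⟩ := exists_rearr_maxFn_le_supAvg hn hB
    obtain ⟨D, hD0, hDle⟩ := hD.lintegral_rpow_le hn
    refine maxSubset_of_rearr_le hn hX fun f hf =>
      ⟨avgAddSup volume (fun s => Φ (s ^ (1 / (n : ℝ)))) fun x => ‖f x‖ₑ, h.1 _ ?_,
        K * (1 + D).toNNReal, fun t ht => ?_⟩
    · exact ⟨hW.aemeasurable_avgAddSup volume _, f, hf, fun _ _ => rfl⟩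
    · refine (hle _ hf.1.enorm t ht).trans ?_
      rw [ENNReal.coe_mul, mul_assoc]
      exact mul_le_mul' le_rfl (hW.supAvg_le_avgAddSup volume hD0 hDle _ ht)

end Embedding

end FracMax

theorem corollary4p2 (n : ℕ) (hn : 1 ≤ n) (Φ : ℝ → ℝ) (hB : FracMax.ClassB n Φ)
    (ρE ρX : (FracMax.Rn n → ℝ≥0∞) → ℝ≥0∞)
    (hE : FracMax.IsRINorm volume ρE) (hX : FracMax.IsRINorm volume ρX) :
    ((FracMax.MaxSubset n Φ ρE ρX ↔ (FracMax.cone₁ n Φ ρE).Embeds (FracMax.luxemburg n ρX)) ∧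
      (FracMax.MaxSubset n Φ ρE ρX ↔ (FracMax.cone₂ n Φ ρE).Embeds (FracMax.luxemburg n ρX)) ∧
      (FracMax.MaxSubset n Φ ρE ρX ↔ (FracMax.cone₃ n Φ ρE).Embeds (FracMax.luxemburg n ρX)) ∧
      (FracMax.MaxSubset n Φ ρE ρX ↔ FracMax.MaxEmbeds n Φ ρE ρX)) ∧
    (FracMax.ClassD n Φ →
      (FracMax.MaxSubset n Φ ρE ρX ↔
        (FracMax.cone₄ n Φ ρE).Embeds (FracMax.luxemburg n ρX))) := by
  exact ⟨⟨FracMax.maxSubset_iff_cone₁_embeds hn hE hX,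
    FracMax.maxSubset_iff_cone₂_embeds hn hB hE hX, FracMax.maxSubset_iff_cone₃_embeds hn hB hE hX,
    FracMax.maxSubset_iff_maxEmbeds hE hX⟩,
    fun hD => FracMax.maxSubset_iff_cone₄_embeds hn hB hD hE hX⟩
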